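/- Let $\pi(z)f(t)=e^{2\pi i\omega\cdot t}f(t-x)$, $z=(x,\omega)\in\mathbb{R}^{2d}$, be the time-frequency shifts on $L^2(\mathbb{R}^d)$, let $\mathcal{HS}$ be the Hilbert–Schmidt operators on $L^2(\mathbb{R}^d)$, and let $\mathfrak{S}'$ be the space of continuous linear operators $\mathscr{S}(\mathbb{R}^d)\to\mathscr{S}'(\mathbb{R}^d)$. For $R,T\in\mathcal{HS}$ put $\mathfrak{V}_RT(z)=R^*\pi(z)^*T\in\mathcal{HS}$. For $R\in\mathcal{HS}$ and $T\in\mathfrak{S}'$, a measurable function $\Psi:\mathbb{R}^{2d}\to\mathcal{HS}$ is $\mathfrak{V}_RT$ if $\langle\Psi(z)f,g\rangle=\langle Tf,\pi(z)Rg\rangle$ as tempered distributions in $z$ for all $f\in\mathscr{S}(\mathbb{R}^d)$, $g\in L^2(\mathbb{R}^d)$, i.e. for every $\varphi\in\mathscr{S}(\mathbb{R}^{2d})$ the function $\overline{\varphi(z)}\langle\Psi(z)f,g\rangle$ is integrable and $$\int_{\mathbb{R}^{2d}}\overline{\varphi(z)}\,\langle\Psi(z)f,g\rangle\,dz=\Big\langle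 Tf,\int_{\mathbb{R}^{2d}}\varphi(z)\,\pi(z)Rg\,dz\Big\rangle ;$$ here $\int\varphi(z)\pi(z)Rg\,dz\in\mathscr{S}(\mathbb{R}^d)$. (Such a $\Psi$ is unique almost everywhere, and for $T\in\mathcal{HS}$ it is $z\mapsto R^*\pi(z)^*T$.) We write $\mathfrak{V}_RT\in L^{p,q}_m$ if such a $\Psi$ exists and lies in $L^{p,q}_m(\mathbb{R}^{2d};\mathcal{HS})$, where $$\|\Psi\|_{L^{p,q}_m}=\Big(\int_{\mathbb{R}^d}\Big(\int_{\mathbb{R}^d}\|\Psi(x,\omega)\|_{\mathcal{HS}}^p\,m(x,\omega)^p\,dx\Big)^{q/p}d\omega\Big)^{1/q},$$ with essential suprema if $p$ or $q$ is $\infty$, and $L^1_v=L^{1,1}_v$. Let $v$ be a positive, locally integrable weight on $\mathbb{R}^{2d}$ of at most polynomial growth with $v(z_1+z_2)\le v(z_1)v(z_2)$ and $v(-z)=v(z)$. Let $m$ be a positive, locally integrable $v$-moderate weight with constant $C_{v,m}$, i.e. $m(z_1+z_2)\le C_{v,m}\,v(z_1)\,m(z_2)$. Let $1\le p,q\le\infty$.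 Let $S_0=\varphi_0\otimes e_0: h\mapsto\langle h,e_0\rangle\varphi_0$, where $\varphi_0(t)=2^{d/4}e^{-\pi|t|^2}$ and $e_0\in L^2(\mathbb{R}^d)$ with $\|e_0\|=1$. Put $$\mathfrak{M}^1_v=\{T\in\mathcal{HS}:\mathfrak{V}_{S_0}T\in L^1_v\},\qquad \mathfrak{M}^{p,q}_m=\{T\in\mathfrak{S}':\mathfrak{V}_{S_0}T\in L^{p,q}_m\},$$ with norms $\|T\|_{\mathfrak{M}^1_v}=\|\mathfrak{V}_{S_0}T\|_{L^1_v}$ and $\|T\|_{\mathfrak{M}^{p,q}_m}=\|\mathfrak{V}_{S_0}T\|_{L^{p,q}_m}$. Then for every non-zero $R\in\mathfrak{M}^1_v$ we have $\mathfrak{V}_RS_0\in L^1_v$, $$\{T\in\mathfrak{S}':\mathfrak{V}_RT\in L^{p,q}_m\}=\mathfrak{M}^{p,q}_m ,$$ and the associated norms are equivalent: for all $T\in\mathfrak{M}^{p,q}_m$, $$\frac{\|R\|_{\mathcal{HS}}^2}{C_{v,m}\,\|R\|_{\mathfrak{M}^1_v}}\,\|T\|_{\mathfrak{M}^{p,q}_m}\le\|\mathfrak{V}_RT\|_{L^{p,q}_m}\le\frac{C_{v,m}\,\|\mathfrak{V}_RS_0\|_{L^1_v}}{\|S_0\|_{\mathcal{HS}}^2}\,\|T\|_{\mathfrak{M}^{p,q}_m}.$$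 -/

import Mathlib

open MeasureTheory SchwartzMap
open scoped ENNReal ComplexConjugate

noncomputable section

/-! ### Hilbert-Schmidt operators -/

section HilbertSchmidt

variable (H : Type*) [NormedAddCommGroup H] [InnerProductSpace ℂ H] [CompleteSpace H]

/-- Index set of a fixed orthonormal basis of the Hilbert space `H`. -/
def HSIndex : Set H := (exists_hilbertBasis ℂ H).choose

/-- A fixed orthonormal basis of the Hilbert space `H`. -/
def hsBasis : HilbertBasis (HSIndex H) ℂ H := (exists_hilbertBasis ℂ H).choose_spec.choose

/-- The bounded operators `T` on `H` with `∑ i, ‖T e i‖ ^ 2 < ∞` for an orthonormal basis `e`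
(equivalently, for every one; the sum, the trace of `T* T`, does not depend on the basis). -/
def hsSubmodule : Submodule ℂ (H →L[ℂ] H) where
  carrier := {T | Memℓp (fun i : HSIndex H => T (hsBasis H i)) 2}
  add_mem' := fun {_ _} hS hT => Memℓp.add hS hT
  zero_mem' := zero_memℓp
  smul_mem' := fun c _ hT => Memℓp.const_smul hT c

/-- The type of Hilbert-Schmidt operators on `H`. It is a type of its own because its norm is the
Hilbert-Schmidt norm and not the operator norm. -/
def HS : Type _ := ↥(hsSubmodule H)

namespace HS

instance : AddCommGroup (HS H) := inferInstanceAs (AddCommGroup ↥(hsSubmodule H))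

instance : Module ℂ (HS H) := inferInstanceAs (Module ℂ ↥(hsSubmodule H))

variable {H}

/-- The bounded operator underlying a Hilbert-Schmidt operator. -/
def op (T : HS H) : H →L[ℂ] H := (T : ↥(hsSubmodule H)).1

/-- A bounded operator with the Hilbert-Schmidt property, as a Hilbert-Schmidt operator. -/
def mk (T : H →L[ℂ] H) (hT : T ∈ hsSubmodule H) : HS H := (⟨T, hT⟩ : ↥(hsSubmodule H))

/-- The family `(T e i)` of the values of `T` on the orthonormal basis, in `ℓ²(H)`. -/
def toEll2 : HS H →ₗ[ℂ] lp (fun _ : HSIndex H => H) 2 where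
  toFun T := ⟨fun i => T.op (hsBasis H i), T.2⟩
  map_add' _ _ := rfl
  map_smul' _ _ := rfl

theorem toEll2_injective : Function.Injective (toEll2 (H := H)) := by
  intro S T h
  have h1 : ∀ i, S.op (hsBasis H i) = T.op (hsBasis H i) := fun i =>
    congrArg (fun a : lp (fun _ : HSIndex H => H) 2 => a i) h
  have h2 : S.op = T.op :=
    ContinuousLinearMap.ext_on
      (Submodule.dense_iff_topologicalClosure_eq_top.mpr (hsBasis H).dense_span)
      (by rintro _ ⟨i, rfl⟩; exact h1 i)
  exact Subtype.ext h2

/-- The Hilbert-Schmidt norm `‖T‖ = (∑ i, ‖T e i‖ ^ 2) ^ (1 / 2)`. -/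
instance : NormedAddCommGroup (HS H) :=
  NormedAddCommGroup.induced (HS H) (lp (fun _ : HSIndex H => H) 2) toEll2 toEll2_injective

instance : NormedSpace ℂ (HS H) :=
  NormedSpace.induced ℂ (HS H) (lp (fun _ : HSIndex H => H) 2) toEll2

theorem norm_sq_eq_tsum (T : HS H) : ‖T‖ ^ 2 = ∑' i, ‖T.op (hsBasis H i)‖ ^ 2 := by
  have h := lp.norm_rpow_eq_tsum (p := 2) (by norm_num) (toEll2 T)
  norm_num at h
  exact h

theorem comp_mem (A : H →L[ℂ] H) (T : HS H) : A ∘L T.op ∈ hsSubmodule H := by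
  have hT : Memℓp (fun i : HSIndex H => T.op (hsBasis H i)) 2 := T.2
  refine memℓp_gen ?_
  have h1 := (hT.summable (by norm_num)).mul_left (‖A‖ ^ (2 : ℝ≥0∞).toReal)
  refine Summable.of_nonneg_of_le (fun i => by positivity) (fun i => ?_) h1
  rw [← Real.mul_rpow (norm_nonneg _) (norm_nonneg _)]
  exact Real.rpow_le_rpow (norm_nonneg _) (A.le_opNorm _) (by positivity)

/-- The composition `A T` of a bounded operator `A` and a Hilbert-Schmidt operator `T`. -/
def leftComp (A : H →L[ℂ] H) (T : HS H) : HS H := mk (A ∘L T.op) (comp_mem A T)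

theorem rankOne_mem (x y : H) : InnerProductSpace.rankOne ℂ x y ∈ hsSubmodule H := by
  refine memℓp_gen ?_
  have h := ((hsBasis H).orthonormal.inner_products_summable y).mul_right (‖x‖ ^ 2)
  refine h.congr (fun i => ?_)
  simp [InnerProductSpace.rankOne_apply, norm_smul, mul_pow, norm_inner_symm]

/-- The rank-one operator `x ⊗ y : h ↦ ⟨h, y⟩ x` (`⟨·, ·⟩` linear in the first argument). -/
def tensor (x y : H) : HS H := mk (InnerProductSpace.rankOne ℂ x y) (rankOne_mem x y)

end HS

end HilbertSchmidt

/-! ### Time-frequency shifts and the Gaussian -/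

/-- `ℝ^d`. -/
abbrev Euc (d : ℕ) : Type := EuclideanSpace ℝ (Fin d)

/-- Phase space `ℝ^{2d} = ℝ^d × ℝ^d`, with points `z = (x, ω)`. -/
abbrev PhaseSpace (d : ℕ) : Type := Euc d × Euc d

/-- `L²(ℝ^d)`, complex-valued. -/
abbrev L2 (d : ℕ) : Type := Lp ℂ 2 (volume : Measure (Euc d))

/-- The translation operator `T_x f (t) = f (t - x)` on `L²(ℝ^d)`. -/
def translation {d : ℕ} (x : Euc d) : L2 d →L[ℂ] L2 d :=
  (Lp.compMeasurePreservingₗᵢ ℂ (fun t : Euc d => t - x)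
    (measurePreserving_sub_right volume x)).toContinuousLinearMap

/-- The character `e^{2 π i ω · t}`. -/
def character {d : ℕ} (ω t : Euc d) : ℂ :=
  Complex.exp (2 * Real.pi * Complex.I * (inner ℝ ω t : ℝ))

theorem norm_character {d : ℕ} (ω t : Euc d) : ‖character ω t‖ = 1 := by
  rw [character, show 2 * (Real.pi : ℂ) * Complex.I * ((inner ℝ ω t : ℝ) : ℂ)
    = ((2 * Real.pi * inner ℝ ω t : ℝ) : ℂ) * Complex.I by push_cast; ring]
  exact Complex.norm_exp_ofReal_mul_I _

theorem continuous_character {d : ℕ} (ω : Euc d) : Continuous (character ω) := by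
  unfold character; fun_prop

theorem memLp_character_mul {d : ℕ} (ω : Euc d) (f : L2 d) :
    MemLp (fun t => character ω t * f t) 2 volume := by
  refine (Lp.memLp f).of_le
    ((continuous_character ω).aestronglyMeasurable.mul (Lp.aestronglyMeasurable f)) ?_
  exact Filter.Eventually.of_forall fun t => by simp [norm_character]

/-- The modulation operator `M_ω f (t) = e^{2 π i ω · t} f (t)` on `L²(ℝ^d)`. -/
def modulation {d : ℕ} (ω : Euc d) : L2 d →L[ℂ] L2 d :=
  LinearMap.mkContinuous
    { toFun := fun f => (memLp_character_mul ω f).toLp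
      map_add' := fun f g => by
        rw [← MemLp.toLp_add]
        refine MemLp.toLp_congr _ _ ?_
        filter_upwards [Lp.coeFn_add f g] with t ht
        rw [Pi.add_apply, ← mul_add, ← Pi.add_apply, ← ht]
      map_smul' := fun c f => by
        rw [RingHom.id_apply, ← MemLp.toLp_const_smul]
        refine MemLp.toLp_congr _ _ ?_
        filter_upwards [Lp.coeFn_smul c f] with t ht
        rw [ht, Pi.smul_apply, Pi.smul_apply, mul_smul_comm] } 1 (fun f => by
        rw [one_mul]
        refine Lp.norm_le_norm_of_ae_le ?_
        filter_upwards [(memLp_character_mul ω f).coeFn_toLp] with t ht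
        simp [ht, norm_character])

/-- The time-frequency shift `π(z) = M_ω T_x`, `z = (x, ω)`. -/
def tfShift {d : ℕ} (z : PhaseSpace d) : L2 d →L[ℂ] L2 d :=
  modulation z.2 ∘L translation z.1

/-- The normalised Gaussian `2^{d/4} e^{-π |t|²}` on `ℝ^d`. -/
def gaussianFun (d : ℕ) (t : Euc d) : ℂ :=
  (((2 : ℝ) ^ ((d : ℝ) / 4) * Real.exp (-Real.pi * ‖t‖ ^ 2) : ℝ) : ℂ)

theorem memLp_gaussianFun (d : ℕ) : MemLp (gaussianFun d) 2 volume := by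
  have hc : Continuous (gaussianFun d) := by unfold gaussianFun; fun_prop
  rw [memLp_two_iff_integrable_sq_norm hc.aestronglyMeasurable]
  have h := (GaussianFourier.integrable_cexp_neg_mul_sq_norm_add (V := Euc d)
    (b := (2 * Real.pi : ℝ)) (by simp [Real.pi_pos]) 0 0).norm.const_mul
      (((2 : ℝ) ^ ((d : ℝ) / 4)) ^ 2)
  refine h.congr (Filter.Eventually.of_forall fun t => ?_)
  simp only [gaussianFun, Complex.norm_real, Complex.norm_exp]
  rw [Real.norm_eq_abs, sq_abs, mul_pow, ← Real.exp_nat_mul]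
  congr 2
  have : (-((2 * Real.pi : ℝ) : ℂ) * (‖t‖ : ℂ) ^ 2 + 0 * ((inner ℝ 0 t : ℝ) : ℂ))
      = ((-(2 * Real.pi) * ‖t‖ ^ 2 : ℝ) : ℂ) := by push_cast; ring
  rw [this, Complex.ofReal_re]
  push_cast; ring

/-- The normalised Gaussian as an element of `L²(ℝ^d)`. -/
def gaussian (d : ℕ) : L2 d := (memLp_gaussianFun d).toLp

/-! ### Weights and mixed-norm spaces -/

/-- A sub-multiplicative weight on phase space: positive, locally integrable,
`v (z₁ + z₂) ≤ v z₁ * v z₂`, symmetric, of at most polynomial growth. -/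
structure IsSubmultWeight {d : ℕ} (v : PhaseSpace d → ℝ) : Prop where
  pos : ∀ z, 0 < v z
  locallyIntegrable : LocallyIntegrable v volume
  submult : ∀ z₁ z₂, v (z₁ + z₂) ≤ v z₁ * v z₂
  symm : ∀ z, v (-z) = v z
  growth : ∃ (A : ℝ) (N : ℕ), ∀ z, v z ≤ A * (1 + ‖z‖) ^ N

/-- `m` is a `v`-moderate weight, with constant `C`. -/
structure IsModerateWeight {d : ℕ} (v m : PhaseSpace d → ℝ) (C : ℝ) : Prop where
  pos : ∀ z, 0 < m z
  locallyIntegrable : LocallyIntegrable m volume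
  moderate : ∀ z₁ z₂, m (z₁ + z₂) ≤ C * v z₁ * m z₂

/-- The norm of `L^{p,q}_m(ℝ^{2d}; B)`,
`(∫ (∫ ‖F (x, ω)‖^p m(x, ω)^p dx)^{q/p} dω)^{1/q}`, with essential suprema if `p` or `q` is `∞`;
the inner norm is in `x`, the outer one in `ω`. -/
def mixedNorm {d : ℕ} {B : Type*} [NormedAddCommGroup B] (p q : ℝ≥0∞) (m : PhaseSpace d → ℝ)
    (F : PhaseSpace d → B) : ℝ≥0∞ :=
  eLpNorm (fun ω : Euc d =>
    eLpNorm (fun x : Euc d => m (x, ω) * ‖F (x, ω)‖) p volume) q volume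

/-- `F ∈ L^{p,q}_m(ℝ^{2d}; B)`. -/
def MemMixed {d : ℕ} {B : Type*} [NormedAddCommGroup B] (p q : ℝ≥0∞) (m : PhaseSpace d → ℝ)
    (F : PhaseSpace d → B) : Prop :=
  AEStronglyMeasurable F volume ∧ mixedNorm p q m F < ∞

/-! ### The operator short-time Fourier transform and the coorbit spaces -/

/-- The operator STFT `V_S T (z) = S* π(z)* T` of Hilbert-Schmidt operators. -/
def opSTFT {d : ℕ} (S T : HS (L2 d)) (z : PhaseSpace d) : HS (L2 d) :=
  HS.leftComp (S.op.adjoint ∘L (tfShift z).adjoint) T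

/-- The Gaussian rank-one window `S₀ = φ₀ ⊗ e₀`. -/
def gaussianWindow {d : ℕ} (e₀ : L2 d) : HS (L2 d) := HS.tensor (gaussian d) e₀

/-- The space `M^1_v` of the Hilbert-Schmidt operators `T` with `V_{S₀} T ∈ L^1_v`. -/
def opM1 {d : ℕ} (e₀ : L2 d) (v : PhaseSpace d → ℝ) : Set (HS (L2 d)) :=
  {T | MemMixed 1 1 v (opSTFT (gaussianWindow e₀) T)}

/-- The dual of the Schwartz operators: the continuous linear operators from the Schwartz space
to the tempered distributions, i.e. the operators whose kernel is a tempered distribution. -/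
abbrev TemperedOp (d : ℕ) : Type := 𝓢(Euc d, ℂ) →L[ℂ] 𝓢'(Euc d, ℂ)

/-- The measurable function `Ψ` is the operator STFT `V_R T (z) = R* π(z)* T` of the tempered operator `T`, in the sense of
tempered distributions on phase space: for Schwartz functions `f` and all `g ∈ L²`,
`⟨Ψ(z) f, g⟩ = ⟨T f, π(z) R g⟩` as distributions in `z`, which means
`∫ conj (φ z) ⟨Ψ(z) f, g⟩ dz = ⟨T f, ∫ φ(z) π(z) R g dz⟩` for all Schwartz functions `φ`.
The function `∫ φ(z) π(z) R g dz` is a Schwartz function, and `k` is its complex conjugate, because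
`⟨T f, h⟩` is conjugate-linear in `h` while `T f` is a linear functional.
`inner ℂ g u` is linear in `u`. -/
def IsOpSTFT {d : ℕ} (R : HS (L2 d)) (T : TemperedOp d) (Ψ : PhaseSpace d → HS (L2 d)) : Prop :=
  AEStronglyMeasurable Ψ volume ∧
  ∀ (φ : 𝓢(PhaseSpace d, ℂ)) (f : 𝓢(Euc d, ℂ)) (g : L2 d),
    Integrable (fun z => conj (φ z) * inner ℂ g ((Ψ z).op (f.toLp 2))) volume ∧
    ∀ k : 𝓢(Euc d, ℂ),
      (k =ᵐ[volume] fun t => conj ((∫ z, φ z • tfShift z (R.op g) : L2 d) t)) →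
      ∫ z, conj (φ z) * inner ℂ g ((Ψ z).op (f.toLp 2)) = T f k

/-- The space `{T : V_R T ∈ L^{p,q}_m(ℝ^{2d}; HS)}` of tempered operators. -/
def opCoorbitWith {d : ℕ} (R : HS (L2 d)) (p q : ℝ≥0∞) (m : PhaseSpace d → ℝ) :
    Set (TemperedOp d) :=
  {T | ∃ Ψ, IsOpSTFT R T Ψ ∧ MemMixed p q m Ψ}

/-- The operator coorbit space `M^{p,q}_m = {T : V_{S₀} T ∈ L^{p,q}_m(ℝ^{2d}; HS)}`. -/
def opCoorbit {d : ℕ} (e₀ : L2 d) (p q : ℝ≥0∞) (m : PhaseSpace d → ℝ) : Set (TemperedOp d) :=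
  opCoorbitWith (gaussianWindow e₀) p q m


/-! ### Consistency: on Hilbert-Schmidt operators the two notions of operator STFT agree -/

section Consistency

variable {d : ℕ}

open Filter Topology

theorem modulation_coe (ω : Euc d) (f : L2 d) :
    modulation ω f =ᵐ[volume] fun t => character ω t * f t :=
  (memLp_character_mul ω f).coeFn_toLp

theorem translation_coe (x : Euc d) (f : L2 d) :
    translation x f =ᵐ[volume] fun t => f (t - x) :=
  Lp.coeFn_compMeasurePreserving f (measurePreserving_sub_right volume x)

theorem norm_modulation (ω : Euc d) (f : L2 d) : ‖modulation ω f‖ = ‖f‖ := by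
  have h : ∀ᵐ t, ‖modulation ω f t‖ = ‖f t‖ := by
    filter_upwards [modulation_coe ω f] with t ht
    simp [ht, norm_character]
  exact le_antisymm (Lp.norm_le_norm_of_ae_le (h.mono fun _ ht => ht.le))
    (Lp.norm_le_norm_of_ae_le (h.mono fun _ ht => ht.ge))

theorem norm_translation (x : Euc d) (f : L2 d) : ‖translation x f‖ = ‖f‖ :=
  (Lp.compMeasurePreservingₗᵢ ℂ (fun t : Euc d => t - x)
    (measurePreserving_sub_right volume x)).norm_map f

theorem norm_tfShift (z : PhaseSpace d) (f : L2 d) : ‖tfShift z f‖ = ‖f‖ := by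
  simp [tfShift, norm_modulation, norm_translation]

theorem modulation_neg (ω : Euc d) (f : L2 d) : modulation ω (modulation (-ω) f) = f := by
  refine Lp.ext ?_
  filter_upwards [modulation_coe ω (modulation (-ω) f), modulation_coe (-ω) f] with t h1 h2
  rw [h1, h2, ← mul_assoc, character, character, ← Complex.exp_add]
  simp

theorem translation_neg (x : Euc d) (f : L2 d) : translation x (translation (-x) f) = f := by
  refine Lp.ext ?_
  filter_upwards [translation_coe x (translation (-x) f),
    (measurePreserving_sub_right volume x).quasiMeasurePreserving.ae (translation_coe (-x) f)]
    with t h1 h2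
  rw [h1, h2]
  simp

theorem tfShift_surjective (z : PhaseSpace d) : Function.Surjective (tfShift z) := fun f =>
  ⟨translation (-z.1) (modulation (-z.2) f), by
    simp [tfShift, translation_neg, modulation_neg]⟩

theorem tfShift_adjoint_tfShift (z : PhaseSpace d) (f : L2 d) :
    (tfShift z).adjoint (tfShift z f) = f :=
  DFunLike.congr_fun ((ContinuousLinearMap.norm_map_iff_adjoint_comp_self (tfShift z)).mp
    (norm_tfShift z)) f

theorem tfShift_tfShift_adjoint (z : PhaseSpace d) (f : L2 d) :
    tfShift z ((tfShift z).adjoint f) = f := by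
  obtain ⟨h, rfl⟩ := tfShift_surjective z f
  rw [tfShift_adjoint_tfShift]

theorem continuous_translation (f : L2 d) : Continuous fun x : Euc d => translation x f := by
  have h : ∀ x : Euc d, translation x f = DomAddAct.mk (-x) +ᵥ f := by
    intro x
    refine Lp.ext ?_
    filter_upwards [translation_coe x f, DomAddAct.vadd_Lp_ae_eq (DomAddAct.mk (-x)) f]
      with t h1 h2
    rw [h1, h2]
    simp [sub_eq_neg_add]
  simp_rw [h]
  have : Fact ((2 : ℝ≥0∞) ≠ ∞) := ⟨by norm_num⟩
  exact (DomAddAct.continuous_mk.comp continuous_neg).vadd continuous_const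

theorem continuous_modulation (f : L2 d) : Continuous fun ω : Euc d => modulation ω f := by
  rw [continuous_iff_continuousAt]
  intro ω₀
  refine (Lp.tendsto_Lp_iff_tendsto_eLpNorm'' (fun ω t => character ω t * f t)
    (fun ω => memLp_character_mul ω f) _ (memLp_character_mul ω₀ f)).mpr ?_
  have key : Tendsto (fun ω : Euc d => ∫⁻ t, ‖character ω t * f t - character ω₀ t * f t‖ₑ ^ (2 : ℝ))
      (𝓝 ω₀) (𝓝 (∫⁻ _ : Euc d, 0)) := by
    refine tendsto_lintegral_filter_of_dominated_convergence'
      (fun t => ‖(2 : ℂ) * f t‖ₑ ^ (2 : ℝ)) ?_ ?_ ?_ ?_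
    · refine Eventually.of_forall fun ω => ?_
      exact (((memLp_character_mul ω f).sub (memLp_character_mul ω₀ f)).1.enorm).pow_const _
    · refine Eventually.of_forall fun ω => Eventually.of_forall fun t => ?_
      gcongr
      rw [enorm_le_iff_norm_le, ← sub_mul, norm_mul, norm_mul]
      gcongr
      refine (norm_sub_le _ _).trans ?_
      simp [norm_character]; norm_num
    · have := ((Lp.memLp f).const_mul (2 : ℂ)).2
      rw [eLpNorm_lt_top_iff_lintegral_rpow_enorm_lt_top (by norm_num) (by norm_num)] at this
      exact this.ne
    · refine Eventually.of_forall fun t => ?_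
      have hc : Continuous fun ω : Euc d =>
          ‖character ω t * f t - character ω₀ t * f t‖ₑ ^ (2 : ℝ) := by
        unfold character
        exact ENNReal.continuous_rpow_const.comp (by fun_prop)
      simpa using hc.tendsto ω₀
  have key2 := (ENNReal.continuous_rpow_const (y := 1 / 2)).tendsto 0 |>.comp
    (by simpa using key)
  simpa [eLpNorm_eq_lintegral_rpow_enorm_toReal, Function.comp_def] using key2

/-- Strong continuity of the time-frequency shifts. -/
theorem continuous_tfShift (f : L2 d) : Continuous fun z : PhaseSpace d => tfShift z f := by
  rw [continuous_iff_continuousAt]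
  intro z₀
  rw [ContinuousAt, tendsto_iff_norm_sub_tendsto_zero]
  have h1 : Tendsto (fun z : PhaseSpace d => ‖translation z.1 f - translation z₀.1 f‖ +
      ‖modulation z.2 (translation z₀.1 f) - modulation z₀.2 (translation z₀.1 f)‖) (𝓝 z₀)
      (𝓝 0) := by
    have hc : Continuous (fun z : PhaseSpace d => ‖translation z.1 f - translation z₀.1 f‖ +
      ‖modulation z.2 (translation z₀.1 f) - modulation z₀.2 (translation z₀.1 f)‖) := by
      have a := (continuous_translation f).comp (continuous_fst (X := Euc d) (Y := Euc d))
      have b := (continuous_modulation (translation z₀.1 f)).comp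
        (continuous_snd (X := Euc d) (Y := Euc d))
      exact (a.sub continuous_const).norm.add (b.sub continuous_const).norm
    simpa using hc.tendsto z₀
  refine squeeze_zero (fun _ => norm_nonneg _) (fun z => ?_) h1
  calc ‖tfShift z f - tfShift z₀ f‖
      = ‖modulation z.2 (translation z.1 f - translation z₀.1 f) +
          (modulation z.2 (translation z₀.1 f) - modulation z₀.2 (translation z₀.1 f))‖ := by
        simp [tfShift]
    _ ≤ _ := (norm_add_le _ _).trans (by rw [norm_modulation])

theorem continuous_tfShift_adjoint (f : L2 d) :
    Continuous fun z : PhaseSpace d => (tfShift z).adjoint f := by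
  rw [continuous_iff_continuousAt]
  intro z₀
  rw [ContinuousAt, tendsto_iff_norm_sub_tendsto_zero]
  have h := ((continuous_const (y := f)).sub
    (continuous_tfShift ((tfShift z₀).adjoint f))).norm.tendsto z₀
  simp only [Pi.sub_apply, tfShift_tfShift_adjoint, sub_self, norm_zero] at h
  refine h.congr fun z => ?_
  rw [← norm_tfShift z ((tfShift z).adjoint f - _), map_sub, tfShift_tfShift_adjoint]

/-- The operator STFT of Hilbert-Schmidt operators is continuous in the Hilbert-Schmidt norm. -/
theorem continuous_opSTFT (S T : HS (L2 d)) : Continuous (opSTFT S T) := by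
  rw [continuous_iff_continuousAt]
  intro z₀
  rw [ContinuousAt, tendsto_iff_norm_sub_tendsto_zero]
  have hT : Summable fun i => ‖T.op (hsBasis (L2 d) i)‖ ^ 2 := by
    have hT : Memℓp (fun i => T.op (hsBasis (L2 d) i)) 2 := T.2
    simpa using hT.summable (by norm_num)
  have key : Tendsto (fun z => ∑' i, ‖(opSTFT S T z - opSTFT S T z₀).op (hsBasis (L2 d) i)‖ ^ 2)
      (𝓝 z₀) (𝓝 (∑' _ : HSIndex (L2 d), (0 : ℝ))) := by
    have hop : ∀ z i, (opSTFT S T z - opSTFT S T z₀).op (hsBasis (L2 d) i) =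
        S.op.adjoint ((tfShift z).adjoint (T.op (hsBasis (L2 d) i)) -
          (tfShift z₀).adjoint (T.op (hsBasis (L2 d) i))) := by
      intro z i
      rw [map_sub]; rfl
    simp_rw [hop]
    refine tendsto_tsum_of_dominated_convergence
      (bound := fun i => (‖S.op.adjoint‖ * 2) ^ 2 * ‖T.op (hsBasis (L2 d) i)‖ ^ 2)
      (hT.mul_left _) (fun i => ?_) (Eventually.of_forall fun z i => ?_)
    · have hc : Continuous fun z => ‖S.op.adjoint ((tfShift z).adjoint (T.op (hsBasis (L2 d) i)) -
          (tfShift z₀).adjoint (T.op (hsBasis (L2 d) i)))‖ ^ 2 :=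
        ((S.op.adjoint.continuous.comp
          ((continuous_tfShift_adjoint _).sub continuous_const)).norm).pow 2
      simpa using hc.tendsto z₀
    · have hn : ∀ z, ‖(tfShift z).adjoint (T.op (hsBasis (L2 d) i))‖ =
          ‖T.op (hsBasis (L2 d) i)‖ := fun z => by
        rw [← norm_tfShift z, tfShift_tfShift_adjoint]
      rw [Real.norm_of_nonneg (by positivity), ← mul_pow, mul_assoc]
      gcongr
      refine (ContinuousLinearMap.le_opNorm _ _).trans ?_
      gcongr
      refine (norm_sub_le _ _).trans ?_
      rw [hn, hn, two_mul]
  simp_rw [← HS.norm_sq_eq_tsum, tsum_zero] at key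
  have h2 := (Real.continuous_sqrt.tendsto 0).comp key
  simpa [Function.comp_def] using h2

theorem inner_opSTFT (R A : HS (L2 d)) (c : ℂ) (g u : L2 d) (z : PhaseSpace d) :
    conj c * inner ℂ g ((opSTFT R A z).op u) = inner ℂ (c • tfShift z (R.op g)) (A.op u) := by
  have hop : (opSTFT R A z).op u = R.op.adjoint ((tfShift z).adjoint (A.op u)) := rfl
  rw [inner_smul_left, hop, ContinuousLinearMap.adjoint_inner_right,
    ContinuousLinearMap.adjoint_inner_right]

theorem integrable_smul_tfShift (φ : 𝓢(PhaseSpace d, ℂ)) (h : L2 d) :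
    Integrable (fun z => φ z • tfShift z h) volume := by
  have : (volume : Measure (PhaseSpace d)).IsAddHaarMeasure :=
    inferInstanceAs ((volume : Measure (Euc d)).prod volume).IsAddHaarMeasure
  refine (φ.integrable (μ := volume)).norm.mul_const ‖h‖ |>.mono'
    (φ.continuous.smul (continuous_tfShift _)).aestronglyMeasurable
    (Eventually.of_forall fun z => ?_)
  rw [norm_smul, norm_tfShift]

theorem integral_inner_smul_tfShift (φ : 𝓢(PhaseSpace d, ℂ)) (h u : L2 d) :
    ∫ z, inner ℂ (φ z • tfShift z h) u = inner ℂ (∫ z, φ z • tfShift z h) u := by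
  rw [← inner_conj_symm, ← integral_inner (integrable_smul_tfShift φ h), ← integral_conj]
  simp only [inner_conj_symm]

/-- If the tempered operator `T` is given by the Hilbert-Schmidt operator `A`, then its operator
STFT in the sense of distributions is `z ↦ R* π(z)* A`. -/
theorem isOpSTFT_opSTFT (R A : HS (L2 d)) (T : TemperedOp d)
    (hT : ∀ f k : 𝓢(Euc d, ℂ), T f k = ∫ t, k t * A.op (f.toLp 2) t) :
    IsOpSTFT R T (opSTFT R A) := by
  refine ⟨(continuous_opSTFT R A).aestronglyMeasurable, fun φ f g => ?_⟩
  have hT' : ∀ k : 𝓢(Euc d, ℂ), T f k = ∫ t, k t * A.op (f.toLp 2) t := hT f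
  generalize f.toLp 2 = u at hT' ⊢
  refine ⟨?_, fun k hk => ?_⟩
  · simp only [inner_opSTFT]
    exact (integrable_smul_tfShift φ (R.op g)).inner_const _
  · simp only [inner_opSTFT]
    rw [integral_inner_smul_tfShift, hT', L2.inner_def]
    refine integral_congr_ae ?_
    filter_upwards [hk] with t ht
    rw [ht, RCLike.inner_apply, mul_comm]

end Consistency

end

/-!
Write `S₀ = φ₀ ⊗ e₀` and `V_R T (z) = R* π(z)* T`. For a rank-one operator `Q = q ⊗ g₀` with `q`
a Schwartz function, and for `Q = R` in the reproducing formula below, formally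
`V_R T (z) = c⁻¹ ∫ R* π(z)* π(w) Q · V_S T (w) dw` with a scalar `c`, because
`∫ π(w) Q S* π(w)* dw = c · I` by Moyal's orthogonality relation. Up to a phase the kernel
`R* π(z)* π(w) Q` is `V_R Q (z - w)`. The change of window is therefore dominated by convolution
with `‖V_R Q‖`, which Young's inequality for `L^1_v * L^{p,q}_m` controls, with constant `C`.

For a tempered operator `T` the formal computation is replaced by the definition. Testing the
defining relation of `V_S T` against the short-time Fourier transform of Schwartz functions and
applying the inversion formula (`integral_stft_smul_tfShift`) evaluates the integrals that appear,
and Fubini's theorem gives the change of window (`IsOpSTFT.changeWindow`). It is used with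
`Q = S₀` to pass from `S₀` to `R`; to return, a Schwartz `q` and a `g₀` with `⟨q, R g₀⟩ ≠ 0` are
chosen. This proves that the spaces agree. The norms are well defined since `V_S T` is unique
almost everywhere (`IsOpSTFT.ae_eq`): multiplying the tested relation by a symplectic character
shifts both Schwartz functions, so the Fourier transform of the difference vanishes.

The return with a Schwartz `q` does not give the stated lower bound. That bound comes from the
reproducing formula (`stftConv_stftConv`): composing the passage from `S₀` to `R` with twisted
convolution by `R` itself gives `‖R‖²` times the identity on transforms for `S₀`, by Moyal's
relation for a Hilbert-Schmidt window (`integral_inner_adjoint_tfShift_adjoint`), so that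
`V_{S₀} T` is `‖R‖⁻²` times the twisted convolution of `V_R T` with kernel built from `V_{S₀} R`.
Finally `‖V_R S₀ (-z)‖ = ‖V_{S₀} R (z)‖` and `v` is even, whence `V_R S₀ ∈ L^1_v`.
-/

noncomputable section

/-! ### Schwartz functions: tensor products, the Gaussian, chirps -/

section Schwartz

open scoped ContDiff

variable {E F : Type*} [NormedAddCommGroup E] [NormedSpace ℝ E]
  [NormedAddCommGroup F] [NormedSpace ℝ F]

theorem norm_iteratedFDeriv_comp_clm_le {G : Type*} [NormedAddCommGroup G] [NormedSpace ℝ G]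
    (a : 𝓢(E, ℂ)) (L : G →L[ℝ] E) (hL : ‖L‖ ≤ 1) (i : ℕ) (x : G) :
    ‖iteratedFDeriv ℝ i (a ∘ L) x‖ ≤ ‖iteratedFDeriv ℝ i a (L x)‖ := by
  rw [L.iteratedFDeriv_comp_right (a.smooth ⊤) x (by exact_mod_cast le_top)]
  refine (ContinuousMultilinearMap.norm_compContinuousLinearMap_le _ _).trans ?_
  refine mul_le_of_le_one_right (norm_nonneg _) ?_
  exact Finset.prod_le_one (fun _ _ => norm_nonneg _) (fun _ _ => hL)

theorem norm_iteratedFDeriv_comp_fst_mul_comp_snd_le (a : 𝓢(E, ℂ)) (b : 𝓢(F, ℂ)) (n : ℕ)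
    (x : E × F) :
    ‖iteratedFDeriv ℝ n (fun y : E × F => a y.1 * b y.2) x‖ ≤
      ∑ i ∈ Finset.range (n + 1), (n.choose i : ℝ) * ‖iteratedFDeriv ℝ i a x.1‖ *
        ‖iteratedFDeriv ℝ (n - i) b x.2‖ := by
  have h := norm_iteratedFDeriv_mul_le (𝕜 := ℝ) (n := n) (N := ∞)
    (f := a ∘ (ContinuousLinearMap.fst ℝ E F)) (g := b ∘ (ContinuousLinearMap.snd ℝ E F))
    ((a.smooth ⊤).comp (ContinuousLinearMap.contDiff _))
    ((b.smooth ⊤).comp (ContinuousLinearMap.contDiff _))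
    (x := x) (by exact_mod_cast le_top)
  refine h.trans (Finset.sum_le_sum fun i _ => ?_)
  gcongr
  · exact norm_iteratedFDeriv_comp_clm_le a _ (ContinuousLinearMap.norm_fst_le ℝ E F) i x
  · exact norm_iteratedFDeriv_comp_clm_le b _ (ContinuousLinearMap.norm_snd_le ℝ E F) (n - i) x

/-- The tensor product `(s, t) ↦ a s * b t` of two Schwartz functions. -/
def SchwartzMap.tensorMul (a : 𝓢(E, ℂ)) (b : 𝓢(F, ℂ)) : 𝓢(E × F, ℂ) where
  toFun x := a x.1 * b x.2
  smooth' := ((a.smooth ⊤).comp contDiff_fst).mul ((b.smooth ⊤).comp contDiff_snd)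
  decay' k n := by
    choose Ca hCa using fun j i => a.decay j i
    choose Cb hCb using fun j i => b.decay j i
    refine ⟨∑ i ∈ Finset.range (n + 1), (n.choose i : ℝ) *
      (Ca k i * Cb 0 (n - i) + Ca 0 i * Cb k (n - i)), fun x => ?_⟩
    calc ‖x‖ ^ k * ‖iteratedFDeriv ℝ n (fun y : E × F => a y.1 * b y.2) x‖
        ≤ (‖x.1‖ ^ k + ‖x.2‖ ^ k) * ∑ i ∈ Finset.range (n + 1), (n.choose i : ℝ) *
            ‖iteratedFDeriv ℝ i a x.1‖ * ‖iteratedFDeriv ℝ (n - i) b x.2‖ := by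
          gcongr
          · rw [Prod.norm_def]
            rcases max_cases ‖x.1‖ ‖x.2‖ with h | h <;> rw [h.1] <;> simp
          · exact norm_iteratedFDeriv_comp_fst_mul_comp_snd_le a b n x
      _ ≤ _ := by
          rw [Finset.mul_sum]
          refine Finset.sum_le_sum fun i _ => ?_
          have h1 := (hCa k i).2 x.1
          have h2 := (hCa 0 i).2 x.1
          have h3 := (hCb k (n - i)).2 x.2
          have h4 := (hCb 0 (n - i)).2 x.2
          simp only [pow_zero, one_mul] at h2 h4
          calc (‖x.1‖ ^ k + ‖x.2‖ ^ k) * ((n.choose i : ℝ) *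
                ‖iteratedFDeriv ℝ i a x.1‖ * ‖iteratedFDeriv ℝ (n - i) b x.2‖)
              = (n.choose i : ℝ) * ((‖x.1‖ ^ k * ‖iteratedFDeriv ℝ i a x.1‖) *
                  ‖iteratedFDeriv ℝ (n - i) b x.2‖ + ‖iteratedFDeriv ℝ i a x.1‖ *
                  (‖x.2‖ ^ k * ‖iteratedFDeriv ℝ (n - i) b x.2‖)) := by ring
            _ ≤ _ := by
              have := (hCa k i).1
              have := (hCa 0 i).1
              gcongr

@[simp]
theorem SchwartzMap.tensorMul_apply (a : 𝓢(E, ℂ)) (b : 𝓢(F, ℂ)) (x : E × F) :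
    a.tensorMul b x = a x.1 * b x.2 := rfl

/-- The complex conjugate of a Schwartz function. -/
def SchwartzMap.conj (f : 𝓢(E, ℂ)) : 𝓢(E, ℂ) :=
  f.postcompCLM (Complex.conjCLE : ℂ →L[ℝ] ℂ)

@[simp]
theorem SchwartzMap.conj_apply (f : 𝓢(E, ℂ)) (x : E) : f.conj x = conj (f x) := by
  simp [SchwartzMap.conj]

theorem hasTemperateGrowth_cexp_ofReal_mul_I :
    (fun r : ℝ => Complex.exp ((r : ℂ) * Complex.I)).HasTemperateGrowth := by
  refine ⟨(Complex.ofRealCLM.contDiff.mul contDiff_const).cexp, fun n => ⟨0, 1, fun x => ?_⟩⟩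
  have h : iteratedDeriv n (fun r : ℝ => Complex.exp ((r : ℂ) * Complex.I)) =
      fun r : ℝ => Complex.I ^ n * Complex.exp ((r : ℂ) * Complex.I) := by
    induction n with
    | zero => simp
    | succ n ih =>
      rw [iteratedDeriv_succ, ih]
      ext r
      have h1 : HasDerivAt (fun r : ℝ => Complex.exp ((r : ℂ) * Complex.I))
          (Complex.exp ((r : ℂ) * Complex.I) * (1 * Complex.I)) r :=
        ((Complex.ofRealCLM.hasDerivAt (x := r)).mul_const Complex.I).cexp
      rw [(h1.const_mul _).deriv]
      ring
  rw [norm_iteratedFDeriv_eq_norm_iteratedDeriv, h]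
  simp [Complex.norm_exp_ofReal_mul_I]

theorem one_add_pow_mul_exp_neg_pi_sq_le (N : ℕ) {r : ℝ} (hr : 0 ≤ r) :
    (1 + r) ^ N * Real.exp (-Real.pi * r ^ 2) ≤ N.factorial * Real.exp 2 := by
  have h1 : (1 + r) ^ N ≤ N.factorial * Real.exp (1 + r) := by
    have := Real.pow_div_factorial_le_exp (1 + r) (by positivity) N
    rwa [div_le_iff₀' (by positivity)] at this
  calc (1 + r) ^ N * Real.exp (-Real.pi * r ^ 2)
      ≤ N.factorial * Real.exp (1 + r) * Real.exp (-Real.pi * r ^ 2) := by gcongr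
    _ = N.factorial * Real.exp (1 + r + -Real.pi * r ^ 2) := by rw [mul_assoc, ← Real.exp_add]
    _ ≤ _ := by
      gcongr
      nlinarith [Real.pi_gt_three, sq_nonneg (r - 1), sq_nonneg r]

/-- The Gaussian `t ↦ e^{-π |t|²}` as a Schwartz function. -/
def SchwartzMap.expNegPiSq (V : Type*) [NormedAddCommGroup V] [InnerProductSpace ℝ V] :
    𝓢(V, ℝ) where
  toFun t := Real.exp (-Real.pi * ‖t‖ ^ 2)
  smooth' := by
    have := contDiff_norm_sq ℝ (E := V) (n := ∞)
    fun_prop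
  decay' k n := by
    have hf : (fun t : V => -Real.pi * ‖t‖ ^ 2).HasTemperateGrowth :=
      (Function.HasTemperateGrowth.const (-Real.pi)).mul (Function.hasTemperateGrowth_norm_sq V)
    obtain ⟨k₁, C₁, hC₁, h₁⟩ := hf.norm_iteratedFDeriv_le_uniform n
    refine ⟨n.factorial * (1 + C₁) ^ n * ((k + k₁ * n).factorial * Real.exp 2), fun x => ?_⟩
    have h2 : ‖iteratedFDeriv ℝ n (fun t : V => Real.exp (-Real.pi * ‖t‖ ^ 2)) x‖ ≤
        n.factorial * Real.exp (-Real.pi * ‖x‖ ^ 2) * ((1 + C₁) * (1 + ‖x‖) ^ k₁) ^ n := by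
      refine norm_iteratedFDeriv_comp_le (g := Real.exp) (N := ∞)
        (f := fun t : V => -Real.pi * ‖t‖ ^ 2)
        Real.contDiff_exp hf.1 (by exact_mod_cast le_top) x (fun i _ => ?_) (fun i hi hin => ?_)
      · rw [norm_iteratedFDeriv_eq_norm_iteratedDeriv]
        simp [iteratedDeriv_eq_iterate, Real.iter_deriv_exp]
      · calc _ ≤ C₁ * (1 + ‖x‖) ^ k₁ := h₁ i hin x
          _ ≤ (1 + C₁) * (1 + ‖x‖) ^ k₁ := by gcongr; simp
          _ ≤ _ := by
            apply le_self_pow₀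
              (one_le_mul_of_one_le_of_one_le (by simp [hC₁]) (by simp [one_le_pow₀]))
            omega
    calc ‖x‖ ^ k * _ ≤ (1 + ‖x‖) ^ k *
          (n.factorial * Real.exp (-Real.pi * ‖x‖ ^ 2) * ((1 + C₁) * (1 + ‖x‖) ^ k₁) ^ n) := by
          gcongr
          simp
      _ = n.factorial * (1 + C₁) ^ n *
          ((1 + ‖x‖) ^ (k + k₁ * n) * Real.exp (-Real.pi * ‖x‖ ^ 2)) := by
          rw [mul_pow, ← pow_mul, pow_add]; ring
      _ ≤ _ := by
          have := one_add_pow_mul_exp_neg_pi_sq_le (k + k₁ * n) (norm_nonneg x)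
          exact mul_le_mul_of_nonneg_left this (by positivity)

@[simp]
theorem SchwartzMap.expNegPiSq_apply {V : Type*} [NormedAddCommGroup V] [InnerProductSpace ℝ V]
    (t : V) : SchwartzMap.expNegPiSq V t = Real.exp (-Real.pi * ‖t‖ ^ 2) := rfl

/-- The normalised Gaussian as a Schwartz function. -/
def gaussianSchwartz (d : ℕ) : 𝓢(Euc d, ℂ) :=
  ((2 : ℝ) ^ ((d : ℝ) / 4)) • (SchwartzMap.expNegPiSq (Euc d)).postcompCLM Complex.ofRealCLM

theorem toLp_gaussianSchwartz (d : ℕ) : (gaussianSchwartz d).toLp 2 = gaussian d := by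
  refine MemLp.toLp_congr _ _ (Filter.Eventually.of_forall fun t => ?_)
  simp [gaussianSchwartz, gaussianFun]

theorem gaussian_ne_zero (d : ℕ) : gaussian d ≠ 0 := by
  intro h
  have h1 : (gaussianSchwartz d).toLp 2 (volume : Measure (Euc d)) = (0 : 𝓢(Euc d, ℂ)).toLp 2 := by
    rw [toLp_gaussianSchwartz, h]
    exact (map_zero (SchwartzMap.toLpCLM ℂ ℂ 2 (volume : Measure (Euc d)))).symm
  have h2 := DFunLike.congr_fun (SchwartzMap.injective_toLp 2 volume h1) 0
  have h3 : gaussianSchwartz d 0 = (((2 : ℝ) ^ ((d : ℝ) / 4) : ℝ) : ℂ) := by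
    simp [gaussianSchwartz]
  rw [h3] at h2
  have : (0 : ℝ) < (2 : ℝ) ^ ((d : ℝ) / 4) := by positivity
  simp at h2
  exact this.ne' (by exact_mod_cast h2)

end Schwartz

/-! ### The short-time Fourier transform of Schwartz functions -/

section STFT

open scoped FourierTransform

variable {d : ℕ}

instance : (volume : Measure (PhaseSpace d)).IsAddHaarMeasure :=
  inferInstanceAs ((volume : Measure (Euc d)).prod volume).IsAddHaarMeasure

theorem character_add_left (ω ω' t : Euc d) :
    character (ω + ω') t = character ω t * character ω' t := by
  rw [character, character, character, ← Complex.exp_add, inner_add_left]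
  push_cast; ring_nf

theorem character_add_right (ω t t' : Euc d) :
    character ω (t + t') = character ω t * character ω t' := by
  rw [character, character, character, ← Complex.exp_add, inner_add_right]
  push_cast; ring_nf

theorem conj_character (ω t : Euc d) : conj (character ω t) = character (-ω) t := by
  rw [character, character, ← Complex.exp_conj]
  simp [map_ofNat]

theorem character_neg_right (ω t : Euc d) : character ω (-t) = character (-ω) t := by
  simp [character]

theorem fourierChar_eq_character (ω t : Euc d) :
    ((Real.fourierChar (inner ℝ ω t) : Circle) : ℂ) = character ω t := by
  rw [Real.fourierChar_apply, character]
  congr 1; push_cast; ring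

theorem tfShift_coe (z : PhaseSpace d) (f : L2 d) :
    tfShift z f =ᵐ[volume] fun t => character z.2 t * f (t - z.1) := by
  filter_upwards [modulation_coe z.2 (translation z.1 f), translation_coe z.1 f] with t h1 h2
  rw [← h2, ← h1]; rfl

/-- `(t, η) ↦ h(t) · conj (𝓕 q η) · e^{-2πi η·t}`; its symplectic Fourier transform is the
short-time Fourier transform of `h` with window `q`. -/
def stftSymbol (q h : 𝓢(Euc d, ℂ)) : 𝓢(WithLp 2 (Euc d × Euc d), ℂ) :=
  smulLeftCLM ℂ (fun w => character (-w.snd) w.fst)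
    (compCLMOfContinuousLinearEquiv ℂ (WithLp.prodContinuousLinearEquiv 2 ℝ (Euc d) (Euc d))
      (h.tensorMul (𝓕 q).conj))

theorem hasTemperateGrowth_chirp :
    (fun w : WithLp 2 (Euc d × Euc d) => character (-w.snd) w.fst).HasTemperateGrowth := by
  have h1 : (fun w : WithLp 2 (Euc d × Euc d) =>
      -(2 * Real.pi) * inner ℝ w.snd w.fst).HasTemperateGrowth := by
    refine (Function.HasTemperateGrowth.const _).mul ?_
    exact (innerSL ℝ (E := Euc d)).bilinear_hasTemperateGrowth
      (WithLp.sndL 2 ℝ (Euc d) (Euc d)).hasTemperateGrowth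
      (WithLp.fstL 2 ℝ (Euc d) (Euc d)).hasTemperateGrowth
  convert hasTemperateGrowth_cexp_ofReal_mul_I.comp h1 using 2 with w
  simp only [character, Function.comp]
  congr 1
  rw [inner_neg_left]
  push_cast; ring

theorem stftSymbol_apply (q h : 𝓢(Euc d, ℂ)) (w : WithLp 2 (Euc d × Euc d)) :
    stftSymbol q h w = character (-w.snd) w.fst * (h w.fst * conj (𝓕 q w.snd)) := by
  rw [stftSymbol, smulLeftCLM_apply_apply hasTemperateGrowth_chirp]
  simp

theorem stftSymbol_toLp (q h : 𝓢(Euc d, ℂ)) (t η : Euc d) :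
    stftSymbol q h (WithLp.toLp 2 (t, η)) = character (-η) t * (h t * conj (𝓕 q η)) :=
  stftSymbol_apply q h _

/-- The linear map `(x, ω) ↦ (ω, -x)`. -/
def symplecticRotation (d : ℕ) : PhaseSpace d ≃L[ℝ] WithLp 2 (Euc d × Euc d) :=
  ((ContinuousLinearEquiv.prodComm ℝ (Euc d) (Euc d)).trans
    ((ContinuousLinearEquiv.refl ℝ (Euc d)).prodCongr (ContinuousLinearEquiv.neg ℝ))).trans
    (WithLp.prodContinuousLinearEquiv 2 ℝ (Euc d) (Euc d)).symm

theorem symplecticRotation_apply (z : PhaseSpace d) :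
    symplecticRotation d z = WithLp.toLp 2 (z.2, -z.1) := rfl

theorem measurePreserving_symplecticRotation :
    MeasurePreserving (symplecticRotation d) volume volume := by
  have h1 : MeasurePreserving (fun z : PhaseSpace d => z.swap) volume volume :=
    Measure.measurePreserving_swap
  have h2 : MeasurePreserving (fun z : PhaseSpace d => (z.1, -z.2)) volume volume :=
    (MeasurePreserving.id _).prod (Measure.measurePreserving_neg volume)
  exact (WithLp.volume_preserving_toLp (Euc d) (Euc d)).comp (h2.comp h1)

/-- The short-time Fourier transform `z ↦ ⟨h, π(z) q⟩` of a Schwartz function with a Schwartz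
window, as a Schwartz function on phase space. -/
def stft (q h : 𝓢(Euc d, ℂ)) : 𝓢(PhaseSpace d, ℂ) :=
  compCLMOfContinuousLinearEquiv ℂ (symplecticRotation d) (𝓕 (stftSymbol q h))

theorem inner_tfShift_toLp (q h : 𝓢(Euc d, ℂ)) (z : PhaseSpace d) :
    inner ℂ (tfShift z (q.toLp 2)) (h.toLp 2) =
      ∫ t, character (-z.2) t * conj (q (t - z.1)) * h t := by
  rw [L2.inner_def]
  refine integral_congr_ae ?_
  filter_upwards [tfShift_coe z (q.toLp 2), h.coeFn_toLp 2,
    (measurePreserving_sub_right volume z.1).quasiMeasurePreserving.ae (q.coeFn_toLp 2 volume)]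
    with t h1 h2 h3
  rw [h1, h2, h3, RCLike.inner_apply, map_mul, conj_character]
  ring

theorem integral_conj_fourier_mul_character (q : 𝓢(Euc d, ℂ)) (s : Euc d) :
    ∫ η, conj (𝓕 q η) * character (-η) s = conj (q s) := by
  have h1 : 𝓕⁻ (𝓕 q) s = q s := by rw [FourierTransform.fourierInv_fourier_eq]
  rw [← h1, fourierInv_coe, Real.fourierInv_eq, ← integral_conj]
  refine integral_congr_ae (Filter.Eventually.of_forall fun η => ?_)
  simp only [Circle.smul_def, smul_eq_mul, map_mul, fourierChar_eq_character, conj_character]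
  ring

theorem stft_apply (q h : 𝓢(Euc d, ℂ)) (z : PhaseSpace d) :
    stft q h z = inner ℂ (tfShift z (q.toLp 2)) (h.toLp 2) := by
  have hint : Integrable (fun w => Real.fourierChar (-inner ℝ w (symplecticRotation d z)) •
      stftSymbol q h w) volume :=
    (Real.fourierIntegral_convergent_iff _).2 (stftSymbol q h).integrable
  rw [inner_tfShift_toLp]
  change 𝓕 (stftSymbol q h) (symplecticRotation d z) = _
  rw [fourier_coe, Real.fourier_eq,
    ← (WithLp.volume_preserving_toLp (Euc d) (Euc d)).integral_comp
      (MeasurableEquiv.toLp 2 _).measurableEmbedding, Measure.volume_eq_prod, integral_prod]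
  rotate_left
  · exact (WithLp.volume_preserving_toLp (Euc d) (Euc d)).integrable_comp_of_integrable hint
  refine integral_congr_ae (Filter.Eventually.of_forall fun t => ?_)
  change ∫ η, _ = _
  beta_reduce
  rw [← integral_conj_fourier_mul_character, ← integral_const_mul, ← integral_mul_const]
  refine integral_congr_ae (Filter.Eventually.of_forall fun η => ?_)
  simp only [stftSymbol_toLp, symplecticRotation_apply, WithLp.prod_inner_apply,
    Circle.smul_def, smul_eq_mul]
  have h1 : ((Real.fourierChar (-(inner ℝ t z.2 + inner ℝ η (-z.1))) : Circle) : ℂ) =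
      character (-z.2) t * character η z.1 := by
    rw [Real.fourierChar_apply, character, character, ← Complex.exp_add, inner_neg_left,
      inner_neg_right, real_inner_comm z.2 t]
    congr 1; push_cast; ring
  rw [h1, sub_eq_add_neg, character_add_right, character_neg_right, neg_neg]
  ring

theorem inner_toLp_toLp (f g : 𝓢(Euc d, ℂ)) :
    inner ℂ (f.toLp 2 : L2 d) (g.toLp 2) = ∫ t, conj (f t) * g t := by
  rw [L2.inner_def]
  refine integral_congr_ae ?_
  filter_upwards [f.coeFn_toLp 2, g.coeFn_toLp 2] with t h1 h2
  rw [h1, h2, RCLike.inner_apply, mul_comm]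

/-- Moyal's orthogonality relation for Schwartz functions. -/
theorem integral_stft_mul_conj_stft (q₁ h₁ q₂ h₂ : 𝓢(Euc d, ℂ)) :
    ∫ z, conj (stft q₂ h₂ z) * stft q₁ h₁ z =
      inner ℂ (h₂.toLp 2 : L2 d) (h₁.toLp 2) * inner ℂ (q₁.toLp 2 : L2 d) (q₂.toLp 2) := by
  have e1 : ∫ z, conj (stft q₂ h₂ z) * stft q₁ h₁ z =
      ∫ w, conj (𝓕 (stftSymbol q₂ h₂) w) * 𝓕 (stftSymbol q₁ h₁) w :=
    measurePreserving_symplecticRotation.integral_comp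
      (symplecticRotation d).toHomeomorph.measurableEmbedding
      (fun w => conj (𝓕 (stftSymbol q₂ h₂) w) * 𝓕 (stftSymbol q₁ h₁) w)
  have e2 := integral_inner_fourier_fourier (stftSymbol q₂ h₂) (stftSymbol q₁ h₁)
  simp only [RCLike.inner_apply'] at e2
  have e3 := integral_inner_fourier_fourier q₁ q₂
  simp only [RCLike.inner_apply'] at e3
  rw [e1, e2, ← (WithLp.volume_preserving_toLp (Euc d) (Euc d)).integral_comp
      (MeasurableEquiv.toLp 2 _).measurableEmbedding, inner_toLp_toLp, inner_toLp_toLp, ← e3,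
    ← integral_prod_mul]
  refine integral_congr_ae (Filter.Eventually.of_forall fun w => ?_)
  obtain ⟨t, η⟩ := w
  simp only [stftSymbol_toLp, map_mul, Complex.conj_conj]
  have h1 : conj (character (-η) t) * character (-η) t = 1 := by
    rw [← Complex.normSq_eq_conj_mul_self, Complex.normSq_eq_norm_sq, norm_character]; simp
  linear_combination (conj (h₂ t) * h₁ t * (conj (𝓕 q₁ η) * 𝓕 q₂ η)) * h1

end STFT

/-! ### Moyal's relation and the composition law of the time-frequency shifts -/

section Moyal

open scoped FourierTransform

variable {d : ℕ}

instance : SecondCountableTopology (L2 d) := by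
  have : Fact ((2 : ℝ≥0∞) ≠ ∞) := ⟨by norm_num⟩
  infer_instance

theorem denseRange_toLp_two :
    DenseRange (fun f : 𝓢(Euc d, ℂ) => (f.toLp 2 : L2 d)) :=
  SchwartzMap.denseRange_toLpCLM (by norm_num)

theorem norm_tfShift_adjoint (z : PhaseSpace d) (f : L2 d) : ‖(tfShift z).adjoint f‖ = ‖f‖ := by
  rw [← norm_tfShift z, tfShift_tfShift_adjoint]

theorem integrable_smul_tfShift_of_integrable {S : PhaseSpace d → ℂ} (hS : Integrable S volume)
    (u : L2 d) : Integrable (fun z => S z • tfShift z u) volume :=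
  (hS.norm.mul_const ‖u‖).mono' (hS.1.smul (continuous_tfShift u).aestronglyMeasurable)
    (Filter.Eventually.of_forall fun z => by rw [norm_smul, norm_tfShift])

theorem integrable_smul_tfShift_adjoint {S : PhaseSpace d → ℂ} (hS : Integrable S volume)
    (u : L2 d) : Integrable (fun z => S z • (tfShift z).adjoint u) volume :=
  (hS.norm.mul_const ‖u‖).mono' (hS.1.smul (continuous_tfShift_adjoint u).aestronglyMeasurable)
    (Filter.Eventually.of_forall fun z => by rw [norm_smul, norm_tfShift_adjoint])

theorem integral_mul_inner_tfShift {S : PhaseSpace d → ℂ} (hS : Integrable S volume)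
    (b u : L2 d) :
    ∫ z, S z * inner ℂ b (tfShift z u) = inner ℂ b (∫ z, S z • tfShift z u) := by
  rw [← integral_inner (integrable_smul_tfShift_of_integrable hS u)]
  simp only [inner_smul_right]

theorem integral_mul_inner_tfShift' {S : PhaseSpace d → ℂ} (hS : Integrable S volume)
    (b u : L2 d) :
    ∫ z, S z * inner ℂ b (tfShift z u) =
      inner ℂ (∫ z, conj (S z) • (tfShift z).adjoint b) u := by
  have hS' : Integrable (fun z => conj (S z)) volume :=
    Complex.conjCLE.toContinuousLinearMap.integrable_comp hS
  rw [← inner_conj_symm, ← integral_inner (integrable_smul_tfShift_adjoint hS' b), ← integral_conj]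
  refine integral_congr_ae (Filter.Eventually.of_forall fun z => ?_)
  simp only [inner_smul_right, map_mul, Complex.conj_conj, inner_conj_symm]
  rw [ContinuousLinearMap.adjoint_inner_left]

/-- A separately continuous function of two vectors that is given by `⟨b, a⟩ ⟨r, u⟩` on a dense
family is given by it everywhere. -/
theorem DenseRange.eq_inner_mul_inner {H X : Type*} [NormedAddCommGroup H]
    [InnerProductSpace ℂ H] {e : X → H} (he : DenseRange e) {B : H → H → ℂ} {a r : H}
    (hr : ∀ b, Continuous (B b)) (hl : ∀ u, Continuous fun b => B b u)
    (h : ∀ x y, B (e y) (e x) = inner ℂ (e y) a * inner ℂ r (e x)) (u b : H) :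
    B b u = inner ℂ b a * inner ℂ r u := by
  have h1 (y : X) := he.equalizer (g := fun u => B (e y) u)
    (h := fun u => inner ℂ (e y) a * inner ℂ r u) (hr _) (by fun_prop) (funext fun x => h x y)
  have h2 := he.equalizer (g := fun b => B b u)
    (h := fun b => inner ℂ b a * inner ℂ r u) (hl _) (by fun_prop)
    (funext fun y => congrFun (h1 y) u)
  exact congrFun h2 b

/-- Both sides of Moyal's relation are continuous in the second pair, as soon as the transform of
the first pair is integrable. -/
theorem moyal_of_schwartz_right {r a : L2 d} (h : Integrable (fun z => inner ℂ (tfShift z r) a))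
    (hs : ∀ u b : 𝓢(Euc d, ℂ), ∫ z, inner ℂ (tfShift z r) a *
      inner ℂ (b.toLp 2 : L2 d) (tfShift z (u.toLp 2)) =
        inner ℂ (b.toLp 2 : L2 d) a * inner ℂ r (u.toLp 2)) (u b : L2 d) :
    ∫ z, inner ℂ (tfShift z r) a * inner ℂ b (tfShift z u) = inner ℂ b a * inner ℂ r u := by
  refine denseRange_toLp_two.eq_inner_mul_inner
    (B := fun b u => ∫ z, inner ℂ (tfShift z r) a * inner ℂ b (tfShift z u))
    (fun b => ?_) (fun u => ?_) hs u b
  · simp_rw [integral_mul_inner_tfShift' h]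
    exact (innerSL ℂ _).continuous
  · simp_rw [integral_mul_inner_tfShift h]
    exact continuous_id.inner continuous_const

theorem integrable_inner_tfShift_toLp (q h : 𝓢(Euc d, ℂ)) :
    Integrable (fun z => inner ℂ (tfShift z (q.toLp 2 : L2 d)) (h.toLp 2)) := by
  simp_rw [← stft_apply]
  exact (stft q h).integrable

/-- Moyal's relation when the transform of one of the two pairs is integrable. -/
theorem moyal_of_integrable {r a : L2 d} (h : Integrable (fun z => inner ℂ (tfShift z r) a))
    (u b : L2 d) :
    ∫ z, inner ℂ (tfShift z r) a * inner ℂ b (tfShift z u) = inner ℂ b a * inner ℂ r u := by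
  refine moyal_of_schwartz_right h (fun u b => ?_) u b
  -- For a Schwartz pair `u`, `b` exchange the roles of the two pairs: the transform of the Schwartz
  -- pair is integrable, so the relation extends from Schwartz functions to `r`, `a`.
  have h1 := moyal_of_schwartz_right (integrable_inner_tfShift_toLp u b) (fun u' b' => ?_) r a
  · have h2 := congrArg conj h1
    rw [← integral_conj] at h2
    simp only [map_mul, inner_conj_symm] at h2
    rw [← h2]
    exact integral_congr_ae (Filter.Eventually.of_forall fun z => mul_comm _ _)
  · rw [← integral_stft_mul_conj_stft]
    refine integral_congr_ae (Filter.Eventually.of_forall fun z => ?_)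
    simp only [stft_apply, inner_conj_symm]
    ring

/-- The inversion formula for the short-time Fourier transform with two different windows. -/
theorem integral_stft_smul_tfShift (q h : 𝓢(Euc d, ℂ)) (u : L2 d) :
    ∫ z, stft q h z • tfShift z u = inner ℂ (q.toLp 2 : L2 d) u • (h.toLp 2 : L2 d) := by
  refine ext_inner_left ℂ fun b => ?_
  rw [← integral_mul_inner_tfShift (stft q h).integrable, inner_smul_right]
  simp_rw [stft_apply]
  rw [moyal_of_integrable (integrable_inner_tfShift_toLp q h), mul_comm]

theorem tfShift_tfShift (z w : PhaseSpace d) (f : L2 d) :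
    tfShift z (tfShift w f) = character (-w.2) z.1 • tfShift (z + w) f := by
  refine Lp.ext ?_
  filter_upwards [tfShift_coe z (tfShift w f), tfShift_coe (z + w) f,
    (measurePreserving_sub_right volume z.1).quasiMeasurePreserving.ae (tfShift_coe w f),
    Lp.coeFn_smul (character (-w.2) z.1) (tfShift (z + w) f)] with t h1 h2 h3 h4
  rw [h1, h3, h4, Pi.smul_apply, h2, smul_eq_mul, Prod.snd_add, Prod.fst_add, character_add_left,
    sub_eq_add_neg t, character_add_right, character_neg_right, ← sub_eq_add_neg, sub_sub]
  ring

theorem character_mul_conj (ω t : Euc d) : character ω t * conj (character ω t) = 1 := by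
  rw [mul_comm, ← Complex.normSq_eq_conj_mul_self, Complex.normSq_eq_norm_sq, norm_character]
  simp

/-- The symplectic character `z ↦ e^{2πi (u₂·z₁ - z₂·u₁)}` that measures the failure of
`π(u)` and `π(z)` to commute. -/
def sympChar (u z : PhaseSpace d) : ℂ := character u.2 z.1 * character (-z.2) u.1

theorem inner_tfShift_tfShift_tfShift (u z : PhaseSpace d) (q h : L2 d) :
    inner ℂ (tfShift z (tfShift u q)) (tfShift u h) =
      sympChar u z * inner ℂ (tfShift z q) h := by
  have h1 : tfShift z (tfShift u q) = conj (sympChar u z) • tfShift u (tfShift z q) := by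
    rw [tfShift_tfShift, tfShift_tfShift, smul_smul, add_comm u z, sympChar, map_mul, mul_assoc,
      mul_comm (conj (character (-z.2) u.1)), character_mul_conj, mul_one, conj_character]
  rw [h1, inner_smul_left, Complex.conj_conj, ← ContinuousLinearMap.adjoint_inner_left,
    ContinuousLinearMap.adjoint_inner_left, ← ContinuousLinearMap.adjoint_inner_right,
    tfShift_adjoint_tfShift]

/-- The time-frequency shift of a Schwartz function. -/
def schwartzTFShift (u : PhaseSpace d) (q : 𝓢(Euc d, ℂ)) : 𝓢(Euc d, ℂ) :=
  smulLeftCLM ℂ (character u.2) (compSubConstCLM ℂ u.1 q)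

theorem hasTemperateGrowth_character (ω : Euc d) : (character ω).HasTemperateGrowth := by
  have h1 : (fun t : Euc d => (2 * Real.pi) * inner ℝ ω t).HasTemperateGrowth :=
    (Function.HasTemperateGrowth.const _).mul (Function.hasTemperateGrowth_inner_right ω)
  convert hasTemperateGrowth_cexp_ofReal_mul_I.comp h1 using 1
  ext t
  simp only [character, Function.comp]
  congr 1
  push_cast; ring

theorem toLp_schwartzTFShift (u : PhaseSpace d) (q : 𝓢(Euc d, ℂ)) :
    ((schwartzTFShift u q).toLp 2 : L2 d) = tfShift u (q.toLp 2) := by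
  refine Lp.ext ?_
  filter_upwards [(schwartzTFShift u q).coeFn_toLp 2 volume, tfShift_coe u (q.toLp 2),
    (measurePreserving_sub_right volume u.1).quasiMeasurePreserving.ae (q.coeFn_toLp 2 volume)]
    with t h1 h2 h3
  rw [h1, h2, h3, schwartzTFShift, smulLeftCLM_apply_apply (hasTemperateGrowth_character _),
    smul_eq_mul, compSubConstCLM_apply]

/-- Shifting window and argument simultaneously modulates the transform by a character. -/
theorem stft_tfShift_tfShift (u z : PhaseSpace d) (q h : 𝓢(Euc d, ℂ)) :
    stft (schwartzTFShift u q) (schwartzTFShift u h) z = sympChar u z * stft q h z := by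
  rw [stft_apply, stft_apply, toLp_schwartzTFShift, toLp_schwartzTFShift,
    inner_tfShift_tfShift_tfShift]

/-- An integrable function whose Fourier transform vanishes is zero almost everywhere. -/
theorem ae_eq_zero_of_fourier_eq_zero {V : Type*} [NormedAddCommGroup V] [InnerProductSpace ℝ V]
    [FiniteDimensional ℝ V] [MeasurableSpace V] [BorelSpace V] {g : V → ℂ} (hg : Integrable g)
    (h : ∀ ξ, 𝓕 g ξ = 0) : g =ᵐ[volume] 0 := by
  refine ae_eq_zero_of_integral_contDiff_smul_eq_zero hg.locallyIntegrable fun ψ h1 h2 => ?_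
  have h3 : HasCompactSupport fun x => (ψ x : ℂ) := h2.comp_left (g := Complex.ofReal) rfl
  -- A test function `s` is the Fourier transform of `𝓕⁻ s`, and `∫ 𝓕 (𝓕⁻ s) g = ∫ (𝓕⁻ s) 𝓕 g`.
  let s : 𝓢(V, ℂ) := h3.toSchwartzMap (Complex.ofRealCLM.contDiff.comp h1)
  have h4 := VectorFourier.integral_fourierIntegral_smul_eq_flip (f := (𝓕⁻ s : 𝓢(V, ℂ))) (g := g)
    (L := innerₗ V) (μ := volume) (ν := volume) Real.continuous_fourierChar
    continuous_inner (𝓕⁻ s : 𝓢(V, ℂ)).integrable hg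
  have h5 : ∀ x, VectorFourier.fourierIntegral Real.fourierChar volume (innerₗ V).flip g x = 0 := by
    intro x; rw [← h x, flip_innerₗ]; rfl
  have h6 : ∀ x, VectorFourier.fourierIntegral Real.fourierChar volume (innerₗ V) (𝓕⁻ s : 𝓢(V, ℂ)) x
      = (ψ x : ℂ) := by
    intro x
    have : 𝓕 (𝓕⁻ s : 𝓢(V, ℂ)) x = s x := by rw [FourierTransform.fourier_fourierInv_eq]
    exact this
  simp only [h5, h6, smul_zero, integral_zero] at h4
  rw [← h4]
  refine integral_congr_ae (Filter.Eventually.of_forall fun x => ?_)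
  simp

/-- Uniqueness for the symplectic Fourier transform, which is the Fourier transform after the
rotation `(x, ω) ↦ (ω, -x)`. -/
theorem ae_eq_zero_of_integral_sympChar_mul_eq_zero {G : PhaseSpace d → ℂ} (hG : Integrable G)
    (h : ∀ u, ∫ z, conj (sympChar u z) * G z = 0) : G =ᵐ[volume] 0 := by
  have hmp := measurePreserving_symplecticRotation (d := d)
  have hme := (symplecticRotation d).toHomeomorph.measurableEmbedding
  let g : WithLp 2 (Euc d × Euc d) → ℂ := fun w => G ((symplecticRotation d).symm w)
  have hgG : ∀ z, g (symplecticRotation d z) = G z := fun z => by simp [g]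
  have hg : Integrable g := by
    rw [← hmp.integrable_comp_emb hme]
    exact hG.congr (Filter.Eventually.of_forall fun z => (hgG z).symm)
  have h0 : g =ᵐ[volume] 0 := by
    refine ae_eq_zero_of_fourier_eq_zero hg fun ξ => ?_
    rw [Real.fourier_eq, ← hmp.integral_comp hme, ← h (-ξ.fst, -ξ.snd)]
    refine integral_congr_ae (Filter.Eventually.of_forall fun z => ?_)
    simp only [hgG, Circle.smul_def, smul_eq_mul, sympChar]
    congr 1
    rw [symplecticRotation_apply, WithLp.prod_inner_apply, map_mul, conj_character, conj_character,
      neg_neg, neg_neg, Real.fourierChar_apply, character, character, ← Complex.exp_add,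
      inner_neg_left, inner_neg_right, real_inner_comm z.1 ξ.snd]
    change Complex.exp (((2 * Real.pi * -(inner ℝ z.2 ξ.fst + -inner ℝ z.1 ξ.snd) : ℝ) : ℂ) * _) = _
    congr 1; push_cast; ring
  have h1 := hmp.quasiMeasurePreserving.ae h0
  filter_upwards [h1] with z hz
  rw [← hgG z, hz]; rfl

end Moyal

/-! ### The space of Hilbert-Schmidt operators -/

theorem HilbertBasis.hasSum_norm_sq_inner {ι H : Type*} [NormedAddCommGroup H]
    [InnerProductSpace ℂ H] (b : HilbertBasis ι ℂ H) (x : H) :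
    HasSum (fun i => ‖inner ℂ (b i) x‖ ^ 2) (‖x‖ ^ 2) := by
  have h := Complex.hasSum_re (b.hasSum_inner_mul_inner x x)
  rw [← RCLike.re_to_complex, inner_self_eq_norm_sq] at h
  refine h.congr_fun fun i => ?_
  rw [← inner_conj_symm x (b i), ← Complex.normSq_eq_conj_mul_self, Complex.normSq_eq_norm_sq,
    Complex.ofReal_re]

theorem HilbertBasis.tsum_enorm_inner_mul_inner_le {ι H : Type*} [NormedAddCommGroup H]
    [InnerProductSpace ℂ H] (b : HilbertBasis ι ℂ H) (x y : H) :
    ∑' i, ‖inner ℂ x (b i) * inner ℂ (b i) y‖ₑ ≤ ‖x‖ₑ * ‖y‖ₑ := by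
  have hx := b.hasSum_norm_sq_inner x
  have hy := b.hasSum_norm_sq_inner y
  have h := Real.summable_and_inner_le_Lp_mul_Lq_tsum_of_nonneg
    (p := 2) (q := 2) (Real.holderConjugate_iff.2 ⟨by norm_num, by norm_num⟩)
    (f := fun i => ‖inner ℂ (b i) x‖) (g := fun i => ‖inner ℂ (b i) y‖)
    (fun _ => norm_nonneg _) (fun _ => norm_nonneg _)
    (by simpa using hx.summable) (by simpa using hy.summable)
  simp only [Real.rpow_two, hx.tsum_eq, hy.tsum_eq, ← Real.sqrt_eq_rpow] at h
  rw [Real.sqrt_sq (norm_nonneg _), Real.sqrt_sq (norm_nonneg _)] at h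
  rw [← ofReal_norm, ← ofReal_norm, ← ENNReal.ofReal_mul (norm_nonneg _)]
  refine le_trans (le_of_eq ?_) (ENNReal.ofReal_le_ofReal h.2)
  rw [ENNReal.ofReal_tsum_of_nonneg (fun _ => by positivity) h.1]
  refine tsum_congr fun i => ?_
  rw [← ofReal_norm, norm_mul, norm_inner_symm x]

/-- The balls of radius `1 / 2` about the members of an orthonormal family are disjoint. -/
theorem Orthonormal.countable_index {ι H : Type*} [NormedAddCommGroup H]
    [InnerProductSpace ℂ H] [SecondCountableTopology H] {v : ι → H} (hv : Orthonormal ℂ v) :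
    Countable ι := by
  refine Pairwise.countable_of_isOpen_disjoint (s := fun i => Metric.ball (v i) (1 / 2))
    (fun i j hij => Metric.ball_disjoint_ball ?_) (fun i => Metric.isOpen_ball)
    (fun i => Metric.nonempty_ball.2 (by norm_num))
  have h1 : ‖v i - v j‖ ^ 2 = 2 := by
    rw [@norm_sub_sq ℂ, hv.2 hij, hv.1, hv.1]; norm_num
  rw [dist_eq_norm]
  nlinarith [norm_nonneg (v i - v j)]

namespace HS

variable {H : Type*} [NormedAddCommGroup H] [InnerProductSpace ℂ H] [CompleteSpace H]

theorem op_injective : Function.Injective (op (H := H)) := fun _ _ h => Subtype.ext h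

theorem summable_norm_sq (T : HS H) : Summable fun i => ‖T.op (hsBasis H i)‖ ^ 2 := by
  have hT : Memℓp (fun i => T.op (hsBasis H i)) 2 := T.2
  simpa using hT.summable (by norm_num)

/-- The operator norm is at most the Hilbert-Schmidt norm; the proof estimates the adjoint by
expanding `T* y` in the basis. -/
theorem norm_op_le (T : HS H) : ‖T.op‖ ≤ ‖T‖ := by
  rw [← LinearIsometryEquiv.norm_map ContinuousLinearMap.adjoint T.op]
  refine ContinuousLinearMap.opNorm_le_bound _ (norm_nonneg _) fun y => ?_
  refine le_of_sq_le_sq ?_ (by positivity)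
  have h1 := (hsBasis H).hasSum_norm_sq_inner (T.op.adjoint y)
  rw [mul_pow, norm_sq_eq_tsum, ← tsum_mul_right]
  refine hasSum_le (fun i => ?_) h1 (T.summable_norm_sq.mul_right _).hasSum
  rw [ContinuousLinearMap.adjoint_inner_right, ← mul_pow]
  gcongr
  exact norm_inner_le_norm _ _

/-- The inclusion of the Hilbert-Schmidt operators into the bounded operators. -/
def opL : HS H →L[ℂ] (H →L[ℂ] H) :=
  LinearMap.mkContinuous { toFun := op, map_add' := fun _ _ => rfl, map_smul' := fun _ _ => rfl } 1
    fun T => by rw [one_mul]; exact T.norm_op_le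

/-- Evaluation of Hilbert-Schmidt operators at a vector. -/
def evalL (x : H) : HS H →L[ℂ] H := (ContinuousLinearMap.apply ℂ H x).comp opL

/-- A Cauchy sequence converges in operator norm and, on the basis, in `ℓ²(H)`; both limits have the
same values on the basis. -/
instance : CompleteSpace (HS H) := by
  refine Metric.complete_of_cauchySeq_tendsto fun u hu => ?_
  obtain ⟨A, hA⟩ := cauchySeq_tendsto_of_complete (opL.uniformContinuous.comp_cauchySeq hu)
  have hiso : Isometry (toEll2 (H := H)) :=
    AddMonoidHomClass.isometry_of_norm toEll2 fun T => rfl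
  obtain ⟨a, ha⟩ := cauchySeq_tendsto_of_complete (hiso.uniformContinuous.comp_cauchySeq hu)
  have hAa : ∀ i, A (hsBasis H i) = a i := fun i => by
    have h1 : Filter.Tendsto (fun n => (u n).op (hsBasis H i)) Filter.atTop
        (nhds (A (hsBasis H i))) :=
      ((ContinuousLinearMap.apply ℂ H (hsBasis H i)).continuous.tendsto A).comp hA
    have h2 : Filter.Tendsto (fun n => (u n).op (hsBasis H i)) Filter.atTop (nhds (a i)) := by
      rw [tendsto_iff_norm_sub_tendsto_zero] at ha ⊢
      exact squeeze_zero (fun _ => norm_nonneg _)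
        (fun n => lp.norm_apply_le_norm (by norm_num) (toEll2 (u n) - a) i) ha
    exact tendsto_nhds_unique h1 h2
  have hmem : A ∈ hsSubmodule H := by
    change Memℓp (fun i : HSIndex H => A (hsBasis H i)) 2
    simp_rw [hAa]
    exact lp.memℓp a
  refine ⟨mk A hmem, hiso.isEmbedding.tendsto_nhds_iff.2 ?_⟩
  have : toEll2 (mk A hmem) = a := lp.ext (funext hAa)
  rw [this]
  exact ha

theorem norm_leftComp_le (A : H →L[ℂ] H) (T : HS H) : ‖leftComp A T‖ ≤ ‖A‖ * ‖T‖ := by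
  refine le_of_sq_le_sq ?_ (by positivity)
  rw [mul_pow, norm_sq_eq_tsum, norm_sq_eq_tsum, ← tsum_mul_left]
  refine (leftComp A T).summable_norm_sq.tsum_le_tsum (fun i => ?_)
    (T.summable_norm_sq.mul_left _)
  rw [← mul_pow]
  gcongr
  exact A.le_opNorm _

theorem norm_tensor (x y : H) : ‖tensor x y‖ = ‖x‖ * ‖y‖ := by
  rw [← sq_eq_sq₀ (norm_nonneg _) (by positivity), norm_sq_eq_tsum, mul_pow, mul_comm,
    ← ((hsBasis H).hasSum_norm_sq_inner y).tsum_eq, ← tsum_mul_right]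
  refine tsum_congr fun i => ?_
  rw [← mul_pow, norm_inner_symm]
  congr 1
  exact norm_smul _ _

@[simp] theorem tensor_op_apply (x y h : H) : (tensor x y).op h = inner ℂ y h • x := rfl

@[simp] theorem leftComp_op_apply (A : H →L[ℂ] H) (T : HS H) (x : H) :
    (leftComp A T).op x = A (T.op x) := rfl

theorem ext_op {S T : HS H} (h : ∀ x, S.op x = T.op x) : S = T :=
  op_injective (ContinuousLinearMap.ext h)

/-- The product of Hilbert-Schmidt operators, as a bounded bilinear map. -/
def mulL : HS H →L[ℂ] HS H →L[ℂ] HS H :=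
  LinearMap.mkContinuous₂
    (LinearMap.mk₂ ℂ (fun S T => leftComp S.op T) (fun _ _ _ => rfl) (fun _ _ _ => rfl)
      (fun S T U => ext_op fun x => map_add S.op _ _)
      (fun c S T => ext_op fun x => map_smul S.op _ _)) 1 fun S T => by
    rw [one_mul]
    exact (norm_leftComp_le _ _).trans (by gcongr; exact S.norm_op_le)

@[simp] theorem mulL_op_apply (S T : HS H) (x : H) : (mulL S T).op x = S.op (T.op x) := rfl

theorem norm_mulL_le (S T : HS H) : ‖mulL S T‖ ≤ ‖S‖ * ‖T‖ :=
  (norm_leftComp_le _ _).trans (by gcongr; exact S.norm_op_le)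

theorem smul_op (c : ℂ) (T : HS H) (x : H) : (c • T).op x = c • T.op x := rfl

theorem inner_integral_op {α : Type*} [MeasurableSpace α] {μ : Measure α} {F : α → HS H}
    (hF : Integrable F μ) (y x : H) :
    inner ℂ y ((∫ a, F a ∂μ).op x) = ∫ a, inner ℂ y ((F a).op x) ∂μ :=
  (((innerSL ℂ y).comp (evalL x)).integral_comp_comm hF).symm

end HS

section HSMoyal

variable {d : ℕ}

instance : Countable (HSIndex (L2 d)) := (hsBasis (L2 d)).orthonormal.countable_index

/-- Moyal's relation for a Hilbert-Schmidt window: `∫ π(z) R R* π(z)* dz = ‖R‖² I` weakly. It is the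
sum over the basis `e` of the scalar relations for the windows `R (e i)`. -/
theorem integral_inner_adjoint_tfShift_adjoint (R : HS (L2 d)) (a b : L2 d)
    (h : Integrable fun z => R.op.adjoint ((tfShift z).adjoint a)) :
    ∫ z, inner ℂ (R.op.adjoint ((tfShift z).adjoint b)) (R.op.adjoint ((tfShift z).adjoint a)) =
      (‖R‖ ^ 2 : ℝ) * inner ℂ b a := by
  set e := hsBasis (L2 d) with he
  let F : HSIndex (L2 d) → PhaseSpace d → ℂ := fun i z =>
    inner ℂ (R.op.adjoint ((tfShift z).adjoint b)) (e i) *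
      inner ℂ (e i) (R.op.adjoint ((tfShift z).adjoint a))
  have hint : ∀ i, Integrable fun z => inner ℂ (tfShift z (R.op (e i))) a := fun i => by
    have h1 := h.const_inner (𝕜 := ℂ) (e i)
    simpa only [ContinuousLinearMap.adjoint_inner_right] using h1
  have hF : ∀ i z, F i z =
      inner ℂ (tfShift z (R.op (e i))) a * inner ℂ b (tfShift z (R.op (e i))) := fun i z => by
    simp only [F, ContinuousLinearMap.adjoint_inner_right, ContinuousLinearMap.adjoint_inner_left]
    rw [mul_comm]
  have hmeas : ∀ i, AEStronglyMeasurable (F i) volume := fun i => by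
    refine (Continuous.mul ?_ ?_).aestronglyMeasurable
    · exact (R.op.adjoint.continuous.comp (continuous_tfShift_adjoint b)).inner continuous_const
    · exact continuous_const.inner (R.op.adjoint.continuous.comp (continuous_tfShift_adjoint a))
  have hfin : ∑' i, ∫⁻ z, ‖F i z‖ₑ ≠ ∞ := by
    rw [← lintegral_tsum fun i => (hmeas i).enorm]
    have hle : ∀ z, ∑' i, ‖F i z‖ₑ ≤
        ‖R.op.adjoint‖ₑ * ‖b‖ₑ * ‖R.op.adjoint ((tfShift z).adjoint a)‖ₑ := fun z => by
      refine (e.tsum_enorm_inner_mul_inner_le _ _).trans ?_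
      gcongr
      refine (ContinuousLinearMap.le_opENorm _ _).trans (le_of_eq ?_)
      congr 1
      rw [← ofReal_norm, norm_tfShift_adjoint, ofReal_norm]
    refine ne_top_of_le_ne_top ?_ (lintegral_mono hle)
    rw [lintegral_const_mul' _ _ (by finiteness)]
    exact ENNReal.mul_ne_top (by finiteness) h.2.ne
  calc _ = ∫ z, ∑' i, F i z := integral_congr_ae (Filter.Eventually.of_forall fun z =>
        (e.tsum_inner_mul_inner _ _).symm)
    _ = ∑' i, ∫ z, F i z := integral_tsum hmeas hfin
    _ = ∑' i, ((‖R.op (e i)‖ ^ 2 : ℝ) : ℂ) * inner ℂ b a := tsum_congr fun i => by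
        simp_rw [hF]
        rw [moyal_of_integrable (hint i), inner_self_eq_norm_sq_to_K, mul_comm]
        simp
    _ = _ := by
        rw [tsum_mul_right, HS.norm_sq_eq_tsum, Complex.ofReal_tsum]

end HSMoyal

/-! ### Minkowski's integral inequality -/

section Minkowski

open scoped NNReal

variable {X A : Type*} [MeasurableSpace X] [MeasurableSpace A] {μ : Measure X} {ν : Measure A}

theorem Measurable.eLpNorm_prod_left [SFinite μ] {G : X → A → ℝ≥0∞}
    (hG : Measurable (Function.uncurry G)) (p : ℝ≥0∞) :
    Measurable fun a => eLpNorm (fun x => G x a) p μ := by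
  rcases eq_or_ne p 0 with rfl | hp0
  · simp
  rcases eq_or_ne p ∞ with rfl | hp
  · refine measurable_of_Ioi fun c => ?_
    have h1 : (fun a => eLpNorm (fun x => G x a) ∞ μ) ⁻¹' Set.Ioi c =
        (fun a => μ ((fun x => (x, a)) ⁻¹' {y | c < Function.uncurry G y})) ⁻¹' Set.Ioi 0 := by
      ext a
      simp only [Set.mem_preimage, Set.mem_Ioi, eLpNorm_exponent_top, eLpNormEssSup, enorm_eq_self]
      rw [← not_iff_not, not_lt, not_lt, nonpos_iff_eq_zero]
      constructor
      · intro h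
        have h2 : ∀ᵐ x ∂μ, G x a ≤ c := by
          filter_upwards [ENNReal.ae_le_essSup fun x => G x a] with x hx using hx.trans h
        simpa [ae_iff] using h2
      · intro h
        refine essSup_le_of_ae_le c ?_
        change ∀ᵐ x ∂μ, G x a ≤ c
        simpa [ae_iff] using h
    rw [h1]
    exact measurable_measure_prodMk_right (measurableSet_lt measurable_const hG) measurableSet_Ioi
  · simp_rw [eLpNorm_eq_lintegral_rpow_enorm_toReal hp0 hp, enorm_eq_self]
    exact ((hG.pow_const _).lintegral_prod_left').pow_const _

/-- Minkowski's integral inequality for exponents `1 < p < ∞`, without a finiteness assumption. -/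
theorem eLpNorm_lintegral_le_of_lt_top [SigmaFinite μ] [SFinite ν] {G : X → A → ℝ≥0∞}
    (hG : Measurable (Function.uncurry G)) {p : ℝ} (hp : 1 < p) :
    (∫⁻ x, (∫⁻ a, G x a ∂ν) ^ p ∂μ) ≤ (∫⁻ a, (∫⁻ x, G x a ^ p ∂μ) ^ (1 / p) ∂ν) ^ p := by
  have hp0 : 0 < p := by linarith
  set q := p.conjExponent with hq
  have hpq : p.HolderConjugate q := Real.HolderConjugate.conjExponent hp
  by_contra! hlt
  set S := ∫⁻ a, (∫⁻ x, G x a ^ p ∂μ) ^ (1 / p) ∂ν with hS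
  -- A simple function of finite integral below the `p`-th power of the left-hand side.
  obtain ⟨g, hg, hgfin, hgS⟩ : ∃ g : SimpleFunc X ℝ≥0, (∀ x, (g x : ℝ≥0∞) ≤
      (∫⁻ a, G x a ∂ν) ^ p) ∧ ∫⁻ x, g x ∂μ < ∞ ∧ S ^ p < ∫⁻ x, g x ∂μ := by
    rw [lintegral_eq_nnreal] at hlt
    obtain ⟨φ, hφ⟩ := lt_iSup_iff.1 hlt
    obtain ⟨hφ1, hφ2⟩ := lt_iSup_iff.1 hφ
    rw [← SimpleFunc.lintegral_eq_lintegral] at hφ2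
    obtain ⟨g, h1, h2, h3⟩ := exists_lt_lintegral_simpleFunc_of_lt_lintegral
      (f := φ) (by simpa using hφ2)
    exact ⟨g, fun x => le_trans (by exact_mod_cast h1 x) (hφ1 x), h2, h3⟩
  set I := ∫⁻ x, (g x : ℝ≥0∞) ∂μ with hI
  have hgm : Measurable fun x => (g x : ℝ≥0∞) := g.measurable.coe_nnreal_ennreal
  have hI0 : I ≠ 0 := (bot_le.trans_lt hgS).ne'
  -- `∫ g ≤ ∫ g^{1/q} ∫ G = ∫ ∫ g^{1/q} G ≤ (∫ g)^{1/q} S` by Tonelli and Hölder.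
  have key : I ≤ I ^ (1 / q) * S := by
    calc I ≤ ∫⁻ x, (g x : ℝ≥0∞) ^ (1 / q) * ∫⁻ a, G x a ∂ν ∂μ := by
          refine lintegral_mono fun x => ?_
          have h1 : (g x : ℝ≥0∞) ^ (1 / p) ≤ ∫⁻ a, G x a ∂ν := by
            have := ENNReal.rpow_le_rpow (hg x) (z := 1 / p) (by positivity)
            rwa [← ENNReal.rpow_mul, mul_one_div_cancel hp0.ne', ENNReal.rpow_one] at this
          calc (g x : ℝ≥0∞) = (g x : ℝ≥0∞) ^ (1 / q) * (g x : ℝ≥0∞) ^ (1 / p) := by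
                rw [← ENNReal.rpow_add_of_nonneg _ _ (one_div_nonneg.2 hpq.symm.nonneg)
                  (by positivity), one_div, one_div, add_comm, hpq.inv_add_inv_eq_one,
                  ENNReal.rpow_one]
            _ ≤ _ := by gcongr
      _ = ∫⁻ x, ∫⁻ a, (g x : ℝ≥0∞) ^ (1 / q) * G x a ∂ν ∂μ := by
          refine lintegral_congr fun x => ?_
          exact (lintegral_const_mul _ (hG.comp (measurable_prodMk_left (x := x)))).symm
      _ = ∫⁻ a, ∫⁻ x, (g x : ℝ≥0∞) ^ (1 / q) * G x a ∂μ ∂ν := by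
          refine lintegral_lintegral_swap (Measurable.aemeasurable ?_)
          exact ((hgm.comp measurable_fst).pow_const _).mul hG
      _ ≤ ∫⁻ a, I ^ (1 / q) * (∫⁻ x, G x a ^ p ∂μ) ^ (1 / p) ∂ν := by
          refine lintegral_mono fun a => ?_
          have h1 := ENNReal.lintegral_mul_le_Lp_mul_Lq μ hpq.symm
            (hgm.pow_const (1 / q)).aemeasurable
            (hG.comp (measurable_prodMk_right (y := a))).aemeasurable
          refine h1.trans (le_of_eq ?_)
          simp_rw [← ENNReal.rpow_mul, one_div_mul_cancel hpq.symm.ne_zero, ENNReal.rpow_one]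
          rfl
      _ = _ := by
          rw [lintegral_const_mul']
          exact ENNReal.rpow_ne_top_of_nonneg (one_div_nonneg.2 hpq.symm.nonneg) hgfin.ne
  have h2 : I ^ (1 / p) ≤ S := by
    have h3 : I = I ^ (1 / q) * I ^ (1 / p) := by
      rw [← ENNReal.rpow_add_of_nonneg _ _ (one_div_nonneg.2 hpq.symm.nonneg)
        (by positivity), one_div, one_div, add_comm, hpq.inv_add_inv_eq_one, ENNReal.rpow_one]
    rw [h3] at key
    nth_rewrite 2 [← h3] at key
    refine (ENNReal.mul_le_mul_iff_right ?_ ?_).1 key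
    · simp [ENNReal.rpow_eq_zero_iff, hI0, hgfin.ne]
    · exact ENNReal.rpow_ne_top_of_nonneg (one_div_nonneg.2 hpq.symm.nonneg) hgfin.ne
  have h4 := ENNReal.rpow_le_rpow h2 hp0.le
  rw [← ENNReal.rpow_mul, one_div_mul_cancel hp0.ne', ENNReal.rpow_one] at h4
  exact absurd h4 (not_le.2 hgS)

/-- Minkowski's integral inequality: the `L^p` norm of an integral is at most the integral of the
`L^p` norms. -/
theorem eLpNorm_lintegral_le [SigmaFinite μ] [SFinite ν] {G : X → A → ℝ≥0∞}
    (hG : Measurable (Function.uncurry G)) {p : ℝ≥0∞} (hp : 1 ≤ p) :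
    eLpNorm (fun x => ∫⁻ a, G x a ∂ν) p μ ≤ ∫⁻ a, eLpNorm (fun x => G x a) p μ ∂ν := by
  rcases eq_or_ne p ∞ with rfl | hpt
  · have hm := hG.eLpNorm_prod_left (μ := μ) ∞
    have h1 : ∀ᵐ y ∂(μ.prod ν), G y.1 y.2 ≤ eLpNorm (fun x => G x y.2) ∞ μ := by
      have h2 : ∀ᵐ y ∂(ν.prod μ), G y.2 y.1 ≤ eLpNorm (fun x => G x y.1) ∞ μ := by
        refine (Measure.ae_prod_iff_ae_ae (measurableSet_le (hG.comp measurable_swap)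
          (hm.comp measurable_fst))).2 ?_
        refine Filter.Eventually.of_forall fun a => ?_
        simpa [eLpNormEssSup] using ENNReal.ae_le_essSup fun x => G x a
      exact Measure.measurePreserving_swap.quasiMeasurePreserving.ae h2
    nth_rewrite 1 [eLpNorm_exponent_top]
    refine essSup_le_of_ae_le _ ?_
    filter_upwards [Measure.ae_ae_of_ae_prod h1] with x hx
    exact lintegral_mono_ae hx
  rcases eq_or_lt_of_le hp with rfl | hp1
  · simp only [eLpNorm_one_eq_lintegral_enorm, enorm_eq_self]
    exact (lintegral_lintegral_swap hG.aemeasurable).le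
  have hp0 : p ≠ 0 := (zero_lt_one.trans hp1).ne'
  have hp1' : 1 < p.toReal := by
    rwa [← ENNReal.toReal_one, ENNReal.toReal_lt_toReal (by simp) hpt]
  simp_rw [eLpNorm_eq_lintegral_rpow_enorm_toReal hp0 hpt, enorm_eq_self]
  have h := ENNReal.rpow_le_rpow (eLpNorm_lintegral_le_of_lt_top (μ := μ) (ν := ν) hG hp1')
    (z := 1 / p.toReal) (by positivity)
  rwa [← ENNReal.rpow_mul _ p.toReal, mul_one_div_cancel (by positivity), ENNReal.rpow_one] at h

end Minkowski

/-! ### Young's inequality in weighted mixed-norm spaces -/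

section Mixed

open scoped NNReal

variable {d : ℕ}

/-- The mixed norm of a `[0, ∞]`-valued function on phase space: `L^p` in `x`, then `L^q` in `ω`. -/
def mixedLNorm (p q : ℝ≥0∞) (F : PhaseSpace d → ℝ≥0∞) : ℝ≥0∞ :=
  eLpNorm (fun ω : Euc d => eLpNorm (fun x : Euc d => F (x, ω)) p volume) q volume

theorem mixedNorm_eq_mixedLNorm {B : Type*} [NormedAddCommGroup B] (p q : ℝ≥0∞)
    {m : PhaseSpace d → ℝ} (hm : ∀ z, 0 < m z) (F : PhaseSpace d → B) :
    mixedNorm p q m F = mixedLNorm p q (fun z => ENNReal.ofReal (m z) * ‖F z‖ₑ) := by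
  unfold mixedNorm mixedLNorm
  congr 1
  ext ω
  refine eLpNorm_congr_enorm_ae (Filter.Eventually.of_forall fun x => ?_)
  rw [enorm_mul, enorm_norm, enorm_eq_self, Real.enorm_of_nonneg (hm _).le]

theorem mixedLNorm_mono {p q : ℝ≥0∞} {F G : PhaseSpace d → ℝ≥0∞} (h : ∀ z, F z ≤ G z) :
    mixedLNorm p q F ≤ mixedLNorm p q G :=
  eLpNorm_mono_enorm fun _ => eLpNorm_mono_enorm fun _ => h _

theorem mixedLNorm_mono_ae {p q : ℝ≥0∞} {F G : PhaseSpace d → ℝ≥0∞}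
    (h : ∀ᵐ z, F z ≤ G z) : mixedLNorm p q F ≤ mixedLNorm p q G := by
  have h1 : ∀ᵐ y : PhaseSpace d, F y.swap ≤ G y.swap :=
    (Measure.measurePreserving_swap (μ := (volume : Measure (Euc d)))
      (ν := (volume : Measure (Euc d)))).quasiMeasurePreserving.ae h
  refine eLpNorm_mono_enorm_ae ?_
  filter_upwards [Measure.ae_ae_of_ae_prod h1] with ω hω
  exact eLpNorm_mono_enorm_ae hω

theorem mixedLNorm_congr_ae {p q : ℝ≥0∞} {F G : PhaseSpace d → ℝ≥0∞}
    (h : F =ᵐ[volume] G) : mixedLNorm p q F = mixedLNorm p q G :=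
  le_antisymm (mixedLNorm_mono_ae h.le) (mixedLNorm_mono_ae h.symm.le)

theorem eLpNorm_const_mul_le {X : Type*} [MeasurableSpace X] {μ : Measure X} (c : ℝ≥0)
    (f : X → ℝ≥0∞) (p : ℝ≥0∞) :
    eLpNorm (fun x => (c : ℝ≥0∞) * f x) p μ ≤ c * eLpNorm f p μ :=
  eLpNorm_le_nnreal_smul_eLpNorm_of_ae_le_mul' (Filter.Eventually.of_forall fun x => by simp) p

theorem mixedLNorm_const_mul_le {p q : ℝ≥0∞} (c : ℝ≥0) (F : PhaseSpace d → ℝ≥0∞) :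
    mixedLNorm p q (fun z => (c : ℝ≥0∞) * F z) ≤ c * mixedLNorm p q F :=
  (eLpNorm_mono_enorm fun _ => eLpNorm_const_mul_le c _ p).trans (eLpNorm_const_mul_le c _ q)

theorem mixedLNorm_one_one {F : PhaseSpace d → ℝ≥0∞} (hF : AEMeasurable F volume) :
    mixedLNorm 1 1 F = ∫⁻ z, F z := by
  simp only [mixedLNorm, eLpNorm_one_eq_lintegral_enorm, enorm_eq_self]
  rw [Measure.volume_eq_prod, lintegral_prod_symm _ (by rwa [← Measure.volume_eq_prod])]

theorem mixedLNorm_conv_le_of_measurable {p q : ℝ≥0∞} (hp : 1 ≤ p) (hq : 1 ≤ q)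
    {k : PhaseSpace d → ℝ≥0} (hk : Measurable k) {F : PhaseSpace d → ℝ≥0∞} (hF : Measurable F) :
    mixedLNorm p q (fun z => ∫⁻ w, k w * F (z - w)) ≤ (∫⁻ w, k w) * mixedLNorm p q F := by
  set Φ : Euc d → ℝ≥0∞ := fun ω => eLpNorm (fun x : Euc d => F (x, ω)) p volume with hΦ
  have hΦm : Measurable Φ := Measurable.eLpNorm_prod_left (G := fun x ω => F (x, ω)) hF p
  have h1 : ∀ ω : Euc d, eLpNorm (fun x : Euc d => ∫⁻ w : PhaseSpace d, k w * F ((x, ω) - w)) p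
      volume ≤ ∫⁻ w : PhaseSpace d, k w * Φ (ω - w.2) := fun ω => by
    refine (eLpNorm_lintegral_le (G := fun (x : Euc d) (w : PhaseSpace d) =>
      (k w : ℝ≥0∞) * F ((x, ω) - w)) ?_ hp).trans (lintegral_mono fun w => ?_)
    · refine Measurable.mul ?_ (hF.comp ?_)
      · exact (hk.comp measurable_snd).coe_nnreal_ennreal
      · exact (measurable_fst.prodMk measurable_const).sub measurable_snd
    · refine (eLpNorm_const_mul_le _ _ p).trans (le_of_eq ?_)
      congr 1
      exact eLpNorm_comp_measurePreserving (g := fun x : Euc d => F (x, ω - w.2))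
        (hF.comp measurable_prodMk_right).aestronglyMeasurable
        (measurePreserving_sub_right volume w.1)
  have h2 : ∀ w : PhaseSpace d, eLpNorm (fun ω : Euc d => (k w : ℝ≥0∞) * Φ (ω - w.2)) q volume ≤
      k w * mixedLNorm p q F := fun w => by
    refine (eLpNorm_const_mul_le _ _ q).trans (le_of_eq ?_)
    congr 1
    exact eLpNorm_comp_measurePreserving hΦm.aestronglyMeasurable
      (measurePreserving_sub_right volume w.2)
  calc mixedLNorm p q (fun z => ∫⁻ w, k w * F (z - w))
      ≤ eLpNorm (fun ω : Euc d => ∫⁻ w : PhaseSpace d, k w * Φ (ω - w.2)) q volume :=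
        eLpNorm_mono_enorm h1
    _ ≤ ∫⁻ w : PhaseSpace d, eLpNorm (fun ω : Euc d => (k w : ℝ≥0∞) * Φ (ω - w.2)) q volume := by
        refine eLpNorm_lintegral_le (G := fun (ω : Euc d) (w : PhaseSpace d) =>
          (k w : ℝ≥0∞) * Φ (ω - w.2)) ?_ hq
        refine Measurable.mul ?_ (hΦm.comp ?_)
        · exact (hk.comp measurable_snd).coe_nnreal_ennreal
        · exact measurable_fst.sub (measurable_snd.comp measurable_snd)
    _ ≤ ∫⁻ w : PhaseSpace d, k w * mixedLNorm p q F := lintegral_mono h2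
    _ = _ := lintegral_mul_const _ hk.coe_nnreal_ennreal

/-- The convolution `z ↦ ∫ k (z - w) G w dw` of `[0, ∞]`-valued functions on phase space. -/
def lconv (k G : PhaseSpace d → ℝ≥0∞) (z : PhaseSpace d) : ℝ≥0∞ :=
  ∫⁻ w, k (z - w) * G w

instance : (volume : Measure (PhaseSpace d)).IsNegInvariant where
  neg_eq_self := ((Measure.measurePreserving_neg (volume : Measure (Euc d))).prod
    (Measure.measurePreserving_neg (volume : Measure (Euc d)))).map_eq

theorem ae_sub_left {P : PhaseSpace d → Prop} (h : ∀ᵐ w, P w) (z : PhaseSpace d) :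
    ∀ᵐ w : PhaseSpace d, P (z - w) :=
  (Measure.measurePreserving_sub_left volume z).quasiMeasurePreserving.ae h

/-- Young's inequality for the mixed-norm spaces. -/
theorem mixedLNorm_lconv_le {p q : ℝ≥0∞} (hp : 1 ≤ p) (hq : 1 ≤ q)
    {k : PhaseSpace d → ℝ≥0∞} (hk : AEMeasurable k volume) (hkt : ∀ z, k z ≠ ∞)
    {F : PhaseSpace d → ℝ≥0∞} (hF : AEMeasurable F volume) :
    mixedLNorm p q (lconv k F) ≤ (∫⁻ w, k w) * mixedLNorm p q F := by
  have hk' : AEMeasurable (fun z => (k z).toNNReal) volume := hk.ennreal_toNNReal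
  set κ := hk'.mk _ with hκ
  set F' := hF.mk _ with hF'
  have h1 : ∀ᵐ w, k w = κ w := by
    filter_upwards [hk'.ae_eq_mk] with w hw
    rw [hκ, ← hw, ENNReal.coe_toNNReal (hkt w)]
  have h2 : lconv k F = fun z => ∫⁻ w, κ w * F' (z - w) := by
    ext z
    rw [← lintegral_sub_left_eq_self _ z]
    refine lintegral_congr_ae ?_
    filter_upwards [ae_sub_left h1 z, hF.ae_eq_mk] with w hw1 hw2
    rw [hw1, sub_sub_cancel, hw2]
  rw [h2, lintegral_congr_ae h1, mixedLNorm_congr_ae hF.ae_eq_mk]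
  exact mixedLNorm_conv_le_of_measurable hp hq hk'.measurable_mk hF.measurable_mk

variable {v m : PhaseSpace d → ℝ} {C : ℝ}

theorem IsModerateWeight.const_pos (hv : IsSubmultWeight v) (hm : IsModerateWeight v m C) :
    0 < C := by
  have h := hm.moderate 0 0
  have h1 := hm.pos (0 + 0)
  have h2 := hm.pos 0
  have h3 := hv.pos 0
  by_contra! hC
  have : C * v 0 * m 0 ≤ 0 :=
    mul_nonpos_of_nonpos_of_nonneg (mul_nonpos_of_nonpos_of_nonneg hC h3.le) h2.le
  linarith

theorem aemeasurable_ofReal_of_locallyIntegrable (h : LocallyIntegrable m volume) :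
    AEMeasurable (fun z => ENNReal.ofReal (m z)) volume :=
  h.aestronglyMeasurable.aemeasurable.ennreal_ofReal

/-- The weighted form of Young's inequality, `L^1_v * L^{p,q}_m ⊆ L^{p,q}_m`. -/
theorem mixedLNorm_weight_mul_lconv_le (hv : IsSubmultWeight v) (hm : IsModerateWeight v m C)
    {p q : ℝ≥0∞} (hp : 1 ≤ p) (hq : 1 ≤ q)
    {k : PhaseSpace d → ℝ≥0∞} (hk : AEMeasurable k volume) (hkt : ∀ z, k z ≠ ∞)
    {G : PhaseSpace d → ℝ≥0∞} (hG : AEMeasurable G volume) :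
    mixedLNorm p q (fun z => ENNReal.ofReal (m z) * lconv k G z) ≤
      ENNReal.ofReal C * (∫⁻ w, ENNReal.ofReal (v w) * k w) *
        mixedLNorm p q (fun z => ENNReal.ofReal (m z) * G z) := by
  have hC := hm.const_pos hv
  have h1 : ∀ z, ENNReal.ofReal (m z) * lconv k G z ≤ (C.toNNReal : ℝ≥0∞) *
      lconv (fun w => ENNReal.ofReal (v w) * k w) (fun w => ENNReal.ofReal (m w) * G w) z := by
    intro z
    rw [lconv, lconv, ← lintegral_const_mul' _ _ ENNReal.ofReal_ne_top,
      ← lintegral_const_mul' _ _ ENNReal.coe_ne_top]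
    refine lintegral_mono fun w => ?_
    have h2 : ENNReal.ofReal (m z) ≤
        ENNReal.ofReal C * ENNReal.ofReal (v (z - w)) * ENNReal.ofReal (m w) := by
      rw [← ENNReal.ofReal_mul hC.le, ← ENNReal.ofReal_mul (mul_nonneg hC.le (hv.pos _).le)]
      refine ENNReal.ofReal_le_ofReal ?_
      simpa using hm.moderate (z - w) w
    calc ENNReal.ofReal (m z) * (k (z - w) * G w)
        ≤ ENNReal.ofReal C * ENNReal.ofReal (v (z - w)) * ENNReal.ofReal (m w) *
          (k (z - w) * G w) := by gcongr
      _ = _ := by rw [ENNReal.ofReal]; ring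
  refine (mixedLNorm_mono h1).trans ((mixedLNorm_const_mul_le _ _).trans ?_)
  rw [mul_assoc]
  refine mul_le_mul' le_rfl (mixedLNorm_lconv_le hp hq ?_ (fun z => ?_) ?_)
  · exact (aemeasurable_ofReal_of_locallyIntegrable hv.locallyIntegrable).mul hk
  · exact ENNReal.mul_ne_top ENNReal.ofReal_ne_top (hkt z)
  · exact (aemeasurable_ofReal_of_locallyIntegrable hm.locallyIntegrable).mul hG

/-- `G` is integrable against some negative power of `1 + ‖z‖`. -/
def TemperedIntegrable (G : PhaseSpace d → ℝ≥0∞) : Prop :=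
  ∃ N : ℕ, ∫⁻ z, ENNReal.ofReal (((1 + ‖z‖) ^ N)⁻¹) * G z < ∞

theorem lintegral_one_add_norm_pow_inv_lt_top {E : Type*} [NormedAddCommGroup E] [NormedSpace ℝ E]
    [FiniteDimensional ℝ E] [MeasurableSpace E] [BorelSpace E] (μ : Measure E)
    [μ.IsAddHaarMeasure] :
    ∫⁻ x : E, ENNReal.ofReal (((1 + ‖x‖) ^ (Module.finrank ℝ E + 1))⁻¹) ∂μ < ∞ := by
  have h := integrable_one_add_norm (E := E) (μ := μ) (r := (Module.finrank ℝ E + 1 : ℕ))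
    (by push_cast; linarith)
  have h2 := h.lintegral_lt_top
  refine lt_of_eq_of_lt (lintegral_congr fun x => ?_) h2
  rw [Real.rpow_neg (by positivity), Real.rpow_natCast]

/-- Hölder's inequality against an integrable weight `w ≤ 1`, read as the inclusion `L^p ⊆ L^1` for
the finite measure with density `w`. -/
theorem lintegral_mul_le_eLpNorm {E : Type*} [MeasurableSpace E] {μ : Measure E}
    {w : E → ℝ≥0∞} (hw : Measurable w) (hw1 : ∀ x, w x ≤ 1) (hwi : ∫⁻ x, w x ∂μ < ∞)
    {p : ℝ≥0∞} (hp : 1 ≤ p) :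
    ∃ c : ℝ≥0, ∀ f : E → ℝ≥0∞, Measurable f → ∫⁻ x, w x * f x ∂μ ≤ c * eLpNorm f p μ := by
  have hle : μ.withDensity w ≤ μ := by
    conv_rhs => rw [← withDensity_one (μ := μ)]
    exact withDensity_mono (Filter.Eventually.of_forall hw1)
  have hfin : (μ.withDensity w) Set.univ ^ (1 / (1 : ℝ≥0∞).toReal - 1 / p.toReal) ≠ ∞ := by
    refine ENNReal.rpow_ne_top_of_nonneg ?_ (by simpa using hwi.ne)
    rcases eq_or_ne p ∞ with rfl | hpt
    · simp
    · have : 1 ≤ p.toReal := by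
        rwa [← ENNReal.toReal_one, ENNReal.toReal_le_toReal (by simp) hpt]
      simp only [ENNReal.toReal_one, one_div, inv_one, sub_nonneg]
      exact inv_le_one_of_one_le₀ this
  refine ⟨((μ.withDensity w) Set.univ ^ (1 / (1 : ℝ≥0∞).toReal - 1 / p.toReal)).toNNReal,
    fun f hf => ?_⟩
  have h1 := eLpNorm_le_eLpNorm_mul_rpow_measure_univ (μ := μ.withDensity w) hp
    hf.aestronglyMeasurable
  rw [eLpNorm_one_eq_lintegral_enorm] at h1
  simp only [enorm_eq_self] at h1
  rw [lintegral_withDensity_eq_lintegral_mul μ hw hf] at h1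
  refine h1.trans ?_
  rw [ENNReal.coe_toNNReal hfin, mul_comm]
  gcongr

theorem temperedIntegrable_of_mixedLNorm_lt_top {p q : ℝ≥0∞} (hp : 1 ≤ p) (hq : 1 ≤ q)
    {F : PhaseSpace d → ℝ≥0∞} (hF : AEMeasurable F volume) (h : mixedLNorm p q F < ∞) :
    TemperedIntegrable F := by
  wlog hFm : Measurable F generalizing F
  · obtain ⟨N, hN⟩ := this hF.measurable_mk.aemeasurable
      (by rwa [← mixedLNorm_congr_ae hF.ae_eq_mk]) hF.measurable_mk
    refine ⟨N, lt_of_eq_of_lt (lintegral_congr_ae ?_) hN⟩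
    filter_upwards [hF.ae_eq_mk] with z hz
    rw [hz]
  set n := Module.finrank ℝ (Euc d) + 1 with hn
  let w : Euc d → ℝ≥0∞ := fun x => ENNReal.ofReal (((1 + ‖x‖) ^ n)⁻¹)
  have hw : Measurable w := by
    refine Measurable.ennreal_ofReal ?_
    fun_prop
  have hw1 : ∀ x, w x ≤ 1 := fun x => by
    simp only [w, ENNReal.ofReal_le_one]
    exact inv_le_one_of_one_le₀ (one_le_pow₀ (by simp))
  have hwi : ∫⁻ x, w x < ∞ := lintegral_one_add_norm_pow_inv_lt_top _
  obtain ⟨c₁, hc₁⟩ := lintegral_mul_le_eLpNorm hw hw1 hwi hp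
  obtain ⟨c₂, hc₂⟩ := lintegral_mul_le_eLpNorm hw hw1 hwi hq
  refine ⟨n + n, ?_⟩
  have hΦm : Measurable fun ω : Euc d => eLpNorm (fun x : Euc d => F (x, ω)) p volume :=
    Measurable.eLpNorm_prod_left (G := fun x ω => F (x, ω)) hFm p
  calc ∫⁻ z, ENNReal.ofReal (((1 + ‖z‖) ^ (n + n))⁻¹) * F z
      ≤ ∫⁻ z : PhaseSpace d, w z.2 * (w z.1 * F z) := by
        refine lintegral_mono fun z => ?_
        rw [← mul_assoc, ← ENNReal.ofReal_mul (by positivity), ← mul_inv, pow_add]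
        gcongr
        · exact norm_snd_le z
        · exact norm_fst_le z
    _ = ∫⁻ ω : Euc d, ∫⁻ x : Euc d, w ω * (w x * F (x, ω)) := by
        rw [Measure.volume_eq_prod, lintegral_prod_symm]
        exact ((hw.comp measurable_snd).mul ((hw.comp measurable_fst).mul hFm)).aemeasurable
    _ ≤ ∫⁻ ω : Euc d, c₁ * (w ω * eLpNorm (fun x : Euc d => F (x, ω)) p volume) := by
        refine lintegral_mono fun ω => ?_
        rw [lintegral_const_mul' _ _ ENNReal.ofReal_ne_top, mul_left_comm]
        exact mul_le_mul' le_rfl (hc₁ _ (hFm.comp measurable_prodMk_right))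
    _ ≤ c₁ * (c₂ * mixedLNorm p q F) := by
        rw [lintegral_const_mul' _ _ ENNReal.coe_ne_top]
        exact mul_le_mul' le_rfl (hc₂ _ hΦm)
    _ < ∞ := ENNReal.mul_lt_top ENNReal.coe_lt_top (ENNReal.mul_lt_top ENNReal.coe_lt_top h)

/-- A moderate weight is bounded below by a negative power of `1 + ‖z‖`, so that functions in
`L^{p,q}_m` are integrable against a sufficiently negative power. -/
theorem temperedIntegrable_of_weight (hv : IsSubmultWeight v) (hm : IsModerateWeight v m C)
    {G : PhaseSpace d → ℝ≥0∞}
    (h : TemperedIntegrable fun z => ENNReal.ofReal (m z) * G z) : TemperedIntegrable G := by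
  obtain ⟨N, hN⟩ := h
  obtain ⟨A, M, hA⟩ := hv.growth
  have hC := hm.const_pos hv
  have hm0 := hm.pos 0
  have hA0 : 0 < A := by
    have := (hv.pos 0).trans_le (hA 0)
    simpa using this
  refine ⟨N + M, ?_⟩
  have hle : ∀ z, ENNReal.ofReal (((1 + ‖z‖) ^ (N + M))⁻¹) * G z ≤
      ENNReal.ofReal (C * A / m 0) *
        (ENNReal.ofReal (((1 + ‖z‖) ^ N)⁻¹) * (ENNReal.ofReal (m z) * G z)) := by
    intro z
    rw [← mul_assoc, ← mul_assoc, ← ENNReal.ofReal_mul (by positivity),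
      ← ENNReal.ofReal_mul (by positivity)]
    gcongr
    -- `m 0 ≤ C v(-z) m(z)` and `v(-z) = v(z)` bound `m` from below.
    have h1 : m 0 ≤ C * (A * (1 + ‖z‖) ^ M) * m z := by
      have h2 := hm.moderate (-z) z
      rw [neg_add_cancel, hv.symm] at h2
      refine h2.trans ?_
      have := hm.pos z
      gcongr
      exact hA z
    rw [pow_add, mul_inv, mul_comm (C * A / m 0), mul_assoc]
    gcongr
    rw [inv_le_iff_one_le_mul₀ (by positivity), div_mul_eq_mul_div, div_mul_eq_mul_div,
      one_le_div hm0]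
    calc m 0 ≤ _ := h1
      _ = _ := by ring
  refine (lintegral_mono hle).trans_lt ?_
  rw [lintegral_const_mul' _ _ ENNReal.ofReal_ne_top]
  exact ENNReal.mul_lt_top ENNReal.ofReal_lt_top hN

theorem TemperedIntegrable.lintegral_schwartz_mul_lt_top {G : PhaseSpace d → ℝ≥0∞}
    (h : TemperedIntegrable G) (φ : 𝓢(PhaseSpace d, ℂ)) : ∫⁻ z, ‖φ z‖ₑ * G z < ∞ := by
  obtain ⟨N, hN⟩ := h
  set c := 2 ^ N * ((Finset.Iic (N, 0)).sup fun m => SchwartzMap.seminorm ℂ m.1 m.2) φ with hc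
  have hφ : ∀ z, ‖φ z‖ₑ ≤ ENNReal.ofReal c * ENNReal.ofReal (((1 + ‖z‖) ^ N)⁻¹) := by
    intro z
    have h1 := φ.one_add_le_sup_seminorm_apply (𝕜 := ℂ) (m := (N, 0)) (k := N) (n := 0) le_rfl
      le_rfl z
    rw [norm_iteratedFDeriv_zero] at h1
    have hc0 : 0 ≤ c := le_trans (by positivity) h1
    rw [← ENNReal.ofReal_mul hc0, ← ofReal_norm]
    refine ENNReal.ofReal_le_ofReal ?_
    rwa [← div_eq_mul_inv, le_div_iff₀ (by positivity), mul_comm]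
  refine (lintegral_mono fun z => mul_le_mul' (hφ z) le_rfl).trans_lt ?_
  simp_rw [mul_assoc]
  rw [lintegral_const_mul' _ _ ENNReal.ofReal_ne_top]
  exact ENNReal.mul_lt_top ENNReal.ofReal_lt_top hN

theorem TemperedIntegrable.ae_lt_top {G : PhaseSpace d → ℝ≥0∞} (h : TemperedIntegrable G)
    (hG : AEMeasurable G volume) : ∀ᵐ z, G z < ∞ := by
  obtain ⟨N, hN⟩ := h
  have hm : Measurable fun z : PhaseSpace d => ENNReal.ofReal (((1 + ‖z‖) ^ N)⁻¹) :=
    Measurable.ennreal_ofReal (by fun_prop)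
  filter_upwards [ae_lt_top' (hm.aemeasurable.mul hG) hN.ne] with z hz
  by_contra hcon
  rw [not_lt, top_le_iff] at hcon
  simp only [Pi.mul_apply, hcon] at hz
  rw [ENNReal.mul_top] at hz
  · exact lt_irrefl _ hz
  · simp only [ne_eq, ENNReal.ofReal_eq_zero, not_le]
    positivity

theorem aemeasurable_lconv {k G : PhaseSpace d → ℝ≥0∞} (hk : Measurable k)
    (hG : AEMeasurable G volume) : AEMeasurable (lconv k G) volume := by
  refine AEMeasurable.lintegral_prod_right' (f := fun y : PhaseSpace d × PhaseSpace d =>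
    k (y.1 - y.2) * G y.2) (AEMeasurable.mul ?_ hG.comp_snd)
  exact (hk.comp (measurable_fst.sub measurable_snd)).aemeasurable

end Mixed

/-! ### The twisted convolution that changes the window -/

section Kernel

variable {d : ℕ}

theorem tfShift_adjoint_tfShift_eq (z w : PhaseSpace d) (f : L2 d) :
    (tfShift z).adjoint (tfShift w f) =
      character (-(z - w).2) w.1 • (tfShift (z - w)).adjoint f := by
  have h := tfShift_tfShift w (z - w) ((tfShift (z - w)).adjoint f)
  rw [tfShift_tfShift_adjoint, add_sub_cancel] at h
  rw [h, map_smul, tfShift_adjoint_tfShift]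

/-- The kernel `R* π(z)* π(w) Q` of the twisted convolution. -/
def stftKernel (R Q : HS (L2 d)) (z w : PhaseSpace d) : HS (L2 d) :=
  character (-(z - w).2) w.1 • opSTFT R Q (z - w)

theorem stftKernel_op_apply (R Q : HS (L2 d)) (z w : PhaseSpace d) (x : L2 d) :
    (stftKernel R Q z w).op x = R.op.adjoint ((tfShift z).adjoint (tfShift w (Q.op x))) := by
  rw [tfShift_adjoint_tfShift_eq, map_smul]
  rfl

theorem norm_stftKernel (R Q : HS (L2 d)) (z w : PhaseSpace d) :
    ‖stftKernel R Q z w‖ = ‖opSTFT R Q (z - w)‖ := by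
  rw [stftKernel, norm_smul, norm_character, one_mul]

theorem continuous_stftKernel (R Q : HS (L2 d)) :
    Continuous fun y : PhaseSpace d × PhaseSpace d => stftKernel R Q y.1 y.2 := by
  have h1 : Continuous fun y : PhaseSpace d × PhaseSpace d =>
      character (-(y.1 - y.2).2) y.2.1 := by
    unfold character
    fun_prop
  exact h1.smul ((continuous_opSTFT R Q).comp (continuous_fst.sub continuous_snd))

/-- The twisted convolution `z ↦ ∫ R* π(z)* π(w) Q Ψ(w) dw`. Up to a constant it turns the
operator short-time Fourier transform `Ψ` of an operator for one window into that for the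
window `R`. -/
def stftConv (R Q : HS (L2 d)) (Ψ : PhaseSpace d → HS (L2 d)) (z : PhaseSpace d) : HS (L2 d) :=
  ∫ w, HS.mulL (stftKernel R Q z w) (Ψ w)

/-- The pointwise majorant of `stftConv R Q Ψ`. -/
def stftConvBound (R Q : HS (L2 d)) (Ψ : PhaseSpace d → HS (L2 d)) : PhaseSpace d → ℝ≥0∞ :=
  lconv (fun w => ‖opSTFT R Q w‖ₑ) (fun w => ‖Ψ w‖ₑ)

theorem HS.enorm_mulL_le (S T : HS (L2 d)) : ‖HS.mulL S T‖ₑ ≤ ‖S‖ₑ * ‖T‖ₑ := by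
  rw [← ofReal_norm, ← ofReal_norm, ← ofReal_norm, ← ENNReal.ofReal_mul (norm_nonneg _)]
  exact ENNReal.ofReal_le_ofReal (HS.norm_mulL_le S T)

theorem HS.enorm_op_apply_le (S : HS (L2 d)) (x : L2 d) : ‖S.op x‖ₑ ≤ ‖S‖ₑ * ‖x‖ₑ := by
  rw [← ofReal_norm, ← ofReal_norm, ← ofReal_norm, ← ENNReal.ofReal_mul (norm_nonneg _)]
  exact ENNReal.ofReal_le_ofReal (S.op.le_of_opNorm_le S.norm_op_le x)

theorem enorm_stftKernel (R Q : HS (L2 d)) (z w : PhaseSpace d) :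
    ‖stftKernel R Q z w‖ₑ = ‖opSTFT R Q (z - w)‖ₑ := by
  rw [← ofReal_norm, norm_stftKernel, ofReal_norm]

theorem enorm_mulL_stftKernel_le (R Q : HS (L2 d)) (Ψ : PhaseSpace d → HS (L2 d))
    (z w : PhaseSpace d) :
    ‖HS.mulL (stftKernel R Q z w) (Ψ w)‖ₑ ≤ ‖opSTFT R Q (z - w)‖ₑ * ‖Ψ w‖ₑ := by
  rw [← enorm_stftKernel]
  exact HS.enorm_mulL_le _ _

theorem aestronglyMeasurable_mulL_stftKernel_prod (R Q : HS (L2 d))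
    {Ψ : PhaseSpace d → HS (L2 d)} (hΨ : AEStronglyMeasurable Ψ volume) :
    AEStronglyMeasurable (fun y : PhaseSpace d × PhaseSpace d =>
      HS.mulL (stftKernel R Q y.1 y.2) (Ψ y.2)) (volume.prod volume) :=
  HS.mulL.aestronglyMeasurable_comp₂ (continuous_stftKernel R Q).aestronglyMeasurable hΨ.comp_snd

theorem aestronglyMeasurable_mulL_stftKernel (R Q : HS (L2 d))
    {Ψ : PhaseSpace d → HS (L2 d)} (hΨ : AEStronglyMeasurable Ψ volume) (z : PhaseSpace d) :
    AEStronglyMeasurable (fun w => HS.mulL (stftKernel R Q z w) (Ψ w)) volume :=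
  HS.mulL.aestronglyMeasurable_comp₂ ((continuous_stftKernel R Q).comp
    (continuous_const.prodMk continuous_id)).aestronglyMeasurable hΨ

theorem aestronglyMeasurable_stftConv (R Q : HS (L2 d)) {Ψ : PhaseSpace d → HS (L2 d)}
    (hΨ : AEStronglyMeasurable Ψ volume) : AEStronglyMeasurable (stftConv R Q Ψ) volume :=
  (aestronglyMeasurable_mulL_stftKernel_prod R Q hΨ).integral_prod_right'

theorem aemeasurable_stftConvBound (R Q : HS (L2 d)) {Ψ : PhaseSpace d → HS (L2 d)}
    (hΨ : AEStronglyMeasurable Ψ volume) : AEMeasurable (stftConvBound R Q Ψ) volume :=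
  aemeasurable_lconv (continuous_opSTFT R Q).enorm.measurable hΨ.enorm

theorem enorm_stftConv_le (R Q : HS (L2 d)) (Ψ : PhaseSpace d → HS (L2 d)) (z : PhaseSpace d) :
    ‖stftConv R Q Ψ z‖ₑ ≤ stftConvBound R Q Ψ z :=
  (enorm_integral_le_lintegral_enorm _).trans
    (lintegral_mono fun w => enorm_mulL_stftKernel_le R Q Ψ z w)

theorem integrable_mulL_stftKernel (R Q : HS (L2 d)) {Ψ : PhaseSpace d → HS (L2 d)}
    (hΨ : AEStronglyMeasurable Ψ volume) {z : PhaseSpace d} (h : stftConvBound R Q Ψ z < ∞) :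
    Integrable (fun w => HS.mulL (stftKernel R Q z w) (Ψ w)) volume :=
  ⟨aestronglyMeasurable_mulL_stftKernel R Q hΨ z,
    (lintegral_mono fun w => enorm_mulL_stftKernel_le R Q Ψ z w).trans_lt h⟩

theorem stftConv_congr_ae (R Q : HS (L2 d)) {Ψ Ψ' : PhaseSpace d → HS (L2 d)}
    (h : Ψ =ᵐ[volume] Ψ') : stftConv R Q Ψ = stftConv R Q Ψ' := by
  ext1 z
  refine integral_congr_ae ?_
  filter_upwards [h] with w hw
  rw [hw]

theorem stftConv_const_smul (R Q : HS (L2 d)) (c : ℂ) (Ψ : PhaseSpace d → HS (L2 d))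
    (z : PhaseSpace d) : stftConv R Q (fun w => c • Ψ w) z = c • stftConv R Q Ψ z := by
  simp only [stftConv, map_smul]
  exact integral_smul _ _

end Kernel

section Transfer

variable {d : ℕ}

theorem SchwartzMap.conj_conj {E : Type*} [NormedAddCommGroup E] [NormedSpace ℝ E]
    (f : 𝓢(E, ℂ)) : f.conj.conj = f := by
  ext x; simp

/-- The defining relation of the operator short-time Fourier transform, tested against the
transform of a Schwartz function `h` with Schwartz window `q`: by the inversion formula the
integral of the shifts of `S g` is a multiple of `h`. -/
theorem IsOpSTFT.integral_conj_stft_mul {S : HS (L2 d)} {T : TemperedOp d}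
    {Ψ : PhaseSpace d → HS (L2 d)} (hΨ : IsOpSTFT S T Ψ) (q h f : 𝓢(Euc d, ℂ)) (g : L2 d) :
    ∫ z, conj (stft q h z) * inner ℂ g ((Ψ z).op (f.toLp 2)) =
      inner ℂ (S.op g) (q.toLp 2) * T f h.conj := by
  have h1 := (hΨ.2 (stft q h) f g).2 (inner ℂ (S.op g) (q.toLp 2 : L2 d) • h.conj) ?_
  · rw [h1, map_smul, smul_eq_mul]
  · rw [integral_stft_smul_tfShift]
    filter_upwards [Lp.coeFn_smul (inner ℂ (q.toLp 2 : L2 d) (S.op g)) (h.toLp 2 : L2 d),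
      h.coeFn_toLp 2 volume] with t h1 h2
    rw [h1, Pi.smul_apply, h2, smul_eq_mul, map_mul, inner_conj_symm]
    simp

theorem enorm_conj_mul_inner_mulL_le (R Q : HS (L2 d)) (Ψ : PhaseSpace d → HS (L2 d)) (a : ℂ)
    (g u : L2 d) (z w : PhaseSpace d) :
    ‖conj a * inner ℂ g ((HS.mulL (stftKernel R Q z w) (Ψ w)).op u)‖ₑ ≤
      ‖g‖ₑ * ‖u‖ₑ * (‖a‖ₑ * (‖opSTFT R Q (z - w)‖ₑ * ‖Ψ w‖ₑ)) := by
  have h1 : ‖inner ℂ g ((HS.mulL (stftKernel R Q z w) (Ψ w)).op u)‖ₑ ≤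
      ‖g‖ₑ * ((‖opSTFT R Q (z - w)‖ₑ * ‖Ψ w‖ₑ) * ‖u‖ₑ) := by
    have h2 : ‖inner ℂ g ((HS.mulL (stftKernel R Q z w) (Ψ w)).op u)‖ₑ ≤
        ‖g‖ₑ * ‖(HS.mulL (stftKernel R Q z w) (Ψ w)).op u‖ₑ := by
      rw [← ofReal_norm, ← ofReal_norm, ← ofReal_norm, ← ENNReal.ofReal_mul (norm_nonneg _)]
      exact ENNReal.ofReal_le_ofReal (norm_inner_le_norm _ _)
    refine h2.trans (mul_le_mul' le_rfl ?_)
    exact (HS.enorm_op_apply_le _ _).trans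
      (mul_le_mul' (enorm_mulL_stftKernel_le R Q Ψ z w) le_rfl)
  rw [enorm_mul, RCLike.enorm_conj]
  calc _ ≤ ‖a‖ₑ * (‖g‖ₑ * ((‖opSTFT R Q (z - w)‖ₑ * ‖Ψ w‖ₑ) * ‖u‖ₑ)) := by gcongr
    _ = _ := by ring

theorem integrable_conj_mul_inner_mulL (R Q : HS (L2 d)) {Ψ : PhaseSpace d → HS (L2 d)}
    (hΨ : AEStronglyMeasurable Ψ volume) (hT : TemperedIntegrable (stftConvBound R Q Ψ))
    (φ : 𝓢(PhaseSpace d, ℂ)) (g u : L2 d) :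
    Integrable (fun y : PhaseSpace d × PhaseSpace d =>
      conj (φ y.1) * inner ℂ g ((HS.mulL (stftKernel R Q y.1 y.2) (Ψ y.2)).op u))
      (volume.prod volume) := by
  have hYm : AEStronglyMeasurable (fun y : PhaseSpace d × PhaseSpace d =>
      conj (φ y.1) * inner ℂ g ((HS.mulL (stftKernel R Q y.1 y.2) (Ψ y.2)).op u))
      (volume.prod volume) := by
    refine AEStronglyMeasurable.mul ?_ (AEStronglyMeasurable.inner aestronglyMeasurable_const ?_)
    · exact (Complex.continuous_conj.comp
        (φ.continuous.comp continuous_fst)).aestronglyMeasurable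
    · exact (HS.evalL u).continuous.comp_aestronglyMeasurable
        (aestronglyMeasurable_mulL_stftKernel_prod R Q hΨ)
  refine ⟨hYm, ?_⟩
  rw [hasFiniteIntegral_iff_enorm, lintegral_prod _ hYm.enorm]
  refine (lintegral_mono fun z => lintegral_mono fun w =>
    enorm_conj_mul_inner_mulL_le R Q Ψ (φ z) g u z w).trans_lt ?_
  have h1 : ∀ z, ∫⁻ w, ‖g‖ₑ * ‖u‖ₑ * (‖φ z‖ₑ * (‖opSTFT R Q (z - w)‖ₑ * ‖Ψ w‖ₑ)) =
      ‖g‖ₑ * ‖u‖ₑ * (‖φ z‖ₑ * stftConvBound R Q Ψ z) := fun z => by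
    rw [lintegral_const_mul' _ _ (by finiteness), lintegral_const_mul' _ _ (by finiteness)]
    rfl
  simp_rw [h1]
  rw [lintegral_const_mul' _ _ (by finiteness)]
  exact ENNReal.mul_lt_top (by finiteness) (hT.lintegral_schwartz_mul_lt_top φ)

theorem ae_integral_conj_mul_inner_mulL (R Q : HS (L2 d)) {Ψ : PhaseSpace d → HS (L2 d)}
    (hΨ : AEStronglyMeasurable Ψ volume) (hT : TemperedIntegrable (stftConvBound R Q Ψ))
    (φ : 𝓢(PhaseSpace d, ℂ)) (g u : L2 d) :
    ∀ᵐ z, ∫ w, conj (φ z) * inner ℂ g ((HS.mulL (stftKernel R Q z w) (Ψ w)).op u) =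
      conj (φ z) * inner ℂ g ((stftConv R Q Ψ z).op u) := by
  filter_upwards [hT.ae_lt_top (aemeasurable_stftConvBound R Q hΨ)] with z hz
  rw [stftConv, HS.inner_integral_op (integrable_mulL_stftKernel R Q hΨ hz),
    ← integral_const_mul]

theorem integral_conj_mul_inner_mulL_tensor (R : HS (L2 d)) (q g₀ : L2 d)
    (Ψ : PhaseSpace d → HS (L2 d)) (φ : 𝓢(PhaseSpace d, ℂ)) (g u : L2 d) (w : PhaseSpace d) :
    ∫ z, conj (φ z) *
        inner ℂ g ((HS.mulL (stftKernel R (HS.tensor q g₀) z w) (Ψ w)).op u) =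
      inner ℂ (∫ z, φ z • tfShift z (R.op g)) (tfShift w q) * inner ℂ g₀ ((Ψ w).op u) := by
  rw [← integral_inner_smul_tfShift, ← integral_mul_const]
  refine integral_congr_ae (Filter.Eventually.of_forall fun z => ?_)
  simp only [HS.mulL_op_apply, stftKernel_op_apply, HS.tensor_op_apply, map_smul,
    inner_smul_right, inner_smul_left]
  rw [ContinuousLinearMap.adjoint_inner_right, ContinuousLinearMap.adjoint_inner_right]
  ring

set_option maxHeartbeats 2000000 in
/-- Change of window for tempered operators: twisted convolution with the rank-one operator
`q ⊗ g₀`, `q` a Schwartz function, turns the transform for the window `S` into the transform for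
the window `R`, up to the factor `⟨q, S g₀⟩`. -/
theorem IsOpSTFT.changeWindow {S R : HS (L2 d)} {T : TemperedOp d}
    {Ψ : PhaseSpace d → HS (L2 d)} (hΨ : IsOpSTFT S T Ψ) (q : 𝓢(Euc d, ℂ)) (g₀ : L2 d)
    (hc : inner ℂ (S.op g₀) (q.toLp 2 : L2 d) ≠ 0)
    (hT : TemperedIntegrable (stftConvBound R (HS.tensor (q.toLp 2) g₀) Ψ)) :
    IsOpSTFT R T fun z => (inner ℂ (S.op g₀) (q.toLp 2 : L2 d))⁻¹ •
      stftConv R (HS.tensor (q.toLp 2) g₀) Ψ z := by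
  refine ⟨(aestronglyMeasurable_stftConv R _ hΨ.1).const_smul (_ : ℂ), fun φ f g => ?_⟩
  have hkey := fun h => hΨ.integral_conj_stft_mul q h f g₀
  generalize hcd : inner ℂ (S.op g₀) (q.toLp 2 : L2 d) = c at *
  have hYint := integrable_conj_mul_inner_mulL R _ hΨ.1 hT φ g (f.toLp 2)
  have hYz := ae_integral_conj_mul_inner_mulL R _ hΨ.1 hT φ g (f.toLp 2)
  simp only [HS.smul_op, inner_smul_right, mul_left_comm _ c⁻¹]
  refine ⟨(hYint.integral_prod_left.congr hYz).const_mul _, fun k hk => ?_⟩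
  -- `conj k` is the Schwartz function `∫ φ(z) π(z) R g dz`, and the integral over `z` for fixed `w`
  -- is a multiple of `⟨conj k, π(w) q⟩`, the conjugate of its short-time Fourier transform.
  have hk' : (k.conj.toLp 2 : L2 d) = ∫ z, φ z • tfShift z (R.op g) := by
    refine Lp.ext ?_
    filter_upwards [k.conj.coeFn_toLp 2 volume, hk] with t h1 h2
    rw [h1, SchwartzMap.conj_apply, h2, Complex.conj_conj]
  rw [integral_const_mul, ← integral_congr_ae hYz, integral_integral_swap hYint]
  simp_rw [integral_conj_mul_inner_mulL_tensor, ← hk']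
  have hw : ∀ w, inner ℂ (k.conj.toLp 2 : L2 d) (tfShift w (q.toLp 2)) =
      conj (stft q k.conj w) := fun w => by rw [stft_apply, inner_conj_symm]
  simp_rw [hw]
  rw [hkey, SchwartzMap.conj_conj, inv_mul_cancel_left₀ hc]

end Transfer

/-! ### Uniqueness of the operator short-time Fourier transform -/

section Unique

variable {d : ℕ}

/-- Multiplying the tested relation by a symplectic character amounts to a time-frequency shift
of window and argument, so that the Fourier transform of the difference vanishes. -/
theorem IsOpSTFT.ae_conj_stft_mul_eq {S : HS (L2 d)} {T : TemperedOp d}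
    {Ψ Ψ' : PhaseSpace d → HS (L2 d)} (hΨ : IsOpSTFT S T Ψ) (hΨ' : IsOpSTFT S T Ψ')
    (q h f : 𝓢(Euc d, ℂ)) (g : L2 d) :
    ∀ᵐ z, conj (stft q h z) * inner ℂ g ((Ψ z).op (f.toLp 2)) =
      conj (stft q h z) * inner ℂ g ((Ψ' z).op (f.toLp 2)) := by
  have h1 := fun u => hΨ.integral_conj_stft_mul (schwartzTFShift u q) (schwartzTFShift u h) f g
  have h1' := fun u => hΨ'.integral_conj_stft_mul (schwartzTFShift u q) (schwartzTFShift u h) f g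
  have h2 := fun k l => (hΨ.2 (stft k l) f g).1
  have h2' := fun k l => (hΨ'.2 (stft k l) f g).1
  generalize (f.toLp 2 : L2 d) = a at *
  have h0 := ae_eq_zero_of_integral_sympChar_mul_eq_zero ((h2 q h).sub (h2' q h)) fun u => by
    have h3 := integral_sub (h2 (schwartzTFShift u q) (schwartzTFShift u h))
      (h2' (schwartzTFShift u q) (schwartzTFShift u h))
    rw [h1, h1', sub_self] at h3
    rw [← h3]
    refine integral_congr_ae (Filter.Eventually.of_forall fun z => ?_)
    simp only [Pi.sub_apply, stft_tfShift_tfShift, map_mul]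
    ring
  filter_upwards [h0] with z hz
  exact sub_eq_zero.1 hz

theorem HS.eq_of_inner_eq_on_dense {H : Type*} [NormedAddCommGroup H] [InnerProductSpace ℂ H]
    [CompleteSpace H] {t : Set H} (ht : Dense t) {A B : HS H}
    (h : ∀ u ∈ t, ∀ g ∈ t, inner ℂ g (A.op u) = inner ℂ g (B.op u)) : A = B := by
  refine HS.op_injective (ContinuousLinearMap.ext_on (s := t) ?_ fun u hu => ?_)
  · exact ht.mono Submodule.subset_span
  · refine ht.eq_of_inner_right ℂ fun g hg => h u hu g hg

/-- A tempered operator has at most one operator short-time Fourier transform. -/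
theorem IsOpSTFT.ae_eq {S : HS (L2 d)} {T : TemperedOp d}
    {Ψ Ψ' : PhaseSpace d → HS (L2 d)} (hΨ : IsOpSTFT S T Ψ) (hΨ' : IsOpSTFT S T Ψ') :
    Ψ =ᵐ[volume] Ψ' := by
  obtain ⟨t, ht, htc, htd⟩ := (denseRange_toLp_two (d := d)).exists_countable_dense_subset
  have hall : ∀ᵐ z, ∀ a ∈ t, ∀ u ∈ t, ∀ g ∈ t,
      conj (inner ℂ (tfShift z (gaussian d)) a) * inner ℂ g ((Ψ z).op u) =
        conj (inner ℂ (tfShift z (gaussian d)) a) * inner ℂ g ((Ψ' z).op u) := by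
    refine (ae_ball_iff htc).2 fun a ha => (ae_ball_iff htc).2 fun u hu =>
      (ae_ball_iff htc).2 fun g _ => ?_
    obtain ⟨h, rfl⟩ := ht ha
    obtain ⟨f, rfl⟩ := ht hu
    have := hΨ.ae_conj_stft_mul_eq hΨ' (gaussianSchwartz d) h f g
    simpa only [stft_apply, toLp_gaussianSchwartz] using this
  filter_upwards [hall] with z hz
  refine HS.eq_of_inner_eq_on_dense htd fun u hu g hg => ?_
  have hne : tfShift z (gaussian d) ≠ 0 := fun h0 => gaussian_ne_zero d <| by
    rw [← norm_eq_zero, ← norm_tfShift z, h0, norm_zero]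
  obtain ⟨a, ha, hane⟩ : ∃ a ∈ t, inner ℂ (tfShift z (gaussian d)) a ≠ 0 := by
    by_contra! hcon
    exact hne (htd.eq_zero_of_inner_left ℂ hcon)
  exact mul_left_cancel₀ ((map_ne_zero _).2 hane) (hz a ha u hu g hg)

end Unique

/-! ### Norm bounds and the reproducing formula for the twisted convolution -/

section Reproducing

variable {d : ℕ} {v m : PhaseSpace d → ℝ} {C : ℝ}

theorem IsSubmultWeight.one_le (hv : IsSubmultWeight v) (z : PhaseSpace d) : 1 ≤ v z := by
  have h0 : 1 ≤ v 0 := by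
    have := hv.submult 0 0
    rw [add_zero] at this
    exact le_of_mul_le_mul_right (by simpa using this) (hv.pos 0)
  have h1 := hv.submult z (-z)
  rw [add_neg_cancel, hv.symm] at h1
  nlinarith [hv.pos z]

theorem mixedNorm_one_one_opSTFT (hv : IsSubmultWeight v) (R Q : HS (L2 d)) :
    mixedNorm 1 1 v (opSTFT R Q) = ∫⁻ z, ENNReal.ofReal (v z) * ‖opSTFT R Q z‖ₑ := by
  rw [mixedNorm_eq_mixedLNorm 1 1 hv.pos, mixedLNorm_one_one]
  exact (aemeasurable_ofReal_of_locallyIntegrable hv.locallyIntegrable).mul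
    (continuous_opSTFT R Q).enorm.measurable.aemeasurable

theorem integrable_opSTFT (hv : IsSubmultWeight v) {R Q : HS (L2 d)}
    (h : mixedNorm 1 1 v (opSTFT R Q) < ∞) : Integrable (opSTFT R Q) volume := by
  refine ⟨(continuous_opSTFT R Q).aestronglyMeasurable, ?_⟩
  rw [mixedNorm_one_one_opSTFT hv] at h
  refine (lintegral_mono fun z => ?_).trans_lt h
  exact le_mul_of_one_le_left' (ENNReal.one_le_ofReal.2 (hv.one_le z))

theorem mixedLNorm_weight_mul_lconv_opSTFT_le (hv : IsSubmultWeight v)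
    (hm : IsModerateWeight v m C) {p q : ℝ≥0∞} (hp : 1 ≤ p) (hq : 1 ≤ q) (R Q : HS (L2 d))
    {G : PhaseSpace d → ℝ≥0∞} (hG : AEMeasurable G volume) :
    mixedLNorm p q (fun z => ENNReal.ofReal (m z) * lconv (fun w => ‖opSTFT R Q w‖ₑ) G z) ≤
      ENNReal.ofReal C * mixedNorm 1 1 v (opSTFT R Q) *
        mixedLNorm p q (fun z => ENNReal.ofReal (m z) * G z) := by
  rw [mixedNorm_one_one_opSTFT hv]
  exact mixedLNorm_weight_mul_lconv_le hv hm hp hq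
    (continuous_opSTFT R Q).enorm.measurable.aemeasurable (fun _ => enorm_ne_top) hG

theorem temperedIntegrable_of_mixedLNorm_weight_mul_lt_top (hv : IsSubmultWeight v)
    (hm : IsModerateWeight v m C) {p q : ℝ≥0∞} (hp : 1 ≤ p) (hq : 1 ≤ q)
    {G : PhaseSpace d → ℝ≥0∞} (hG : AEMeasurable G volume)
    (h : mixedLNorm p q (fun z => ENNReal.ofReal (m z) * G z) < ∞) : TemperedIntegrable G :=
  temperedIntegrable_of_weight hv hm (temperedIntegrable_of_mixedLNorm_lt_top hp hq
    ((aemeasurable_ofReal_of_locallyIntegrable hm.locallyIntegrable).mul hG) h)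

theorem mixedLNorm_weight_mul_stftConvBound_le (hv : IsSubmultWeight v)
    (hm : IsModerateWeight v m C) {p q : ℝ≥0∞} (hp : 1 ≤ p) (hq : 1 ≤ q) (R Q : HS (L2 d))
    {Ψ : PhaseSpace d → HS (L2 d)} (hΨ : AEStronglyMeasurable Ψ volume) :
    mixedLNorm p q (fun z => ENNReal.ofReal (m z) * stftConvBound R Q Ψ z) ≤
      ENNReal.ofReal C * mixedNorm 1 1 v (opSTFT R Q) * mixedNorm p q m Ψ := by
  rw [mixedNorm_eq_mixedLNorm p q hm.pos]
  exact mixedLNorm_weight_mul_lconv_opSTFT_le hv hm hp hq R Q hΨ.enorm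

theorem mixedLNorm_weight_mul_stftConvBound_lt_top (hv : IsSubmultWeight v)
    (hm : IsModerateWeight v m C) {p q : ℝ≥0∞} (hp : 1 ≤ p) (hq : 1 ≤ q) {R Q : HS (L2 d)}
    (hRQ : mixedNorm 1 1 v (opSTFT R Q) < ∞)
    {Ψ : PhaseSpace d → HS (L2 d)} (hΨ : MemMixed p q m Ψ) :
    mixedLNorm p q (fun z => ENNReal.ofReal (m z) * stftConvBound R Q Ψ z) < ∞ :=
  (mixedLNorm_weight_mul_stftConvBound_le hv hm hp hq R Q hΨ.1).trans_lt
    (ENNReal.mul_lt_top (ENNReal.mul_lt_top ENNReal.ofReal_lt_top hRQ) hΨ.2)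

theorem temperedIntegrable_stftConvBound (hv : IsSubmultWeight v)
    (hm : IsModerateWeight v m C) {p q : ℝ≥0∞} (hp : 1 ≤ p) (hq : 1 ≤ q) {R Q : HS (L2 d)}
    (hRQ : mixedNorm 1 1 v (opSTFT R Q) < ∞)
    {Ψ : PhaseSpace d → HS (L2 d)} (hΨ : MemMixed p q m Ψ) :
    TemperedIntegrable (stftConvBound R Q Ψ) :=
  temperedIntegrable_of_mixedLNorm_weight_mul_lt_top hv hm hp hq
    (aemeasurable_stftConvBound R Q hΨ.1)
    (mixedLNorm_weight_mul_stftConvBound_lt_top hv hm hp hq hRQ hΨ)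

theorem mixedNorm_const_smul_le {B : Type*} [NormedAddCommGroup B] [NormedSpace ℂ B]
    (hm : ∀ z, 0 < m z) (p q : ℝ≥0∞) (c : ℂ) (Ψ : PhaseSpace d → B) :
    mixedNorm p q m (fun z => c • Ψ z) ≤ ‖c‖ₑ * mixedNorm p q m Ψ := by
  rw [mixedNorm_eq_mixedLNorm p q hm, mixedNorm_eq_mixedLNorm p q hm]
  refine (mixedLNorm_mono fun z => ?_).trans (mixedLNorm_const_mul_le ‖c‖₊ _)
  rw [enorm_smul, mul_left_comm]
  rfl

theorem mixedNorm_congr_ae {B : Type*} [NormedAddCommGroup B] (hm : ∀ z, 0 < m z) (p q : ℝ≥0∞)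
    {Ψ Ψ' : PhaseSpace d → B} (h : Ψ =ᵐ[volume] Ψ') :
    mixedNorm p q m Ψ = mixedNorm p q m Ψ' := by
  rw [mixedNorm_eq_mixedLNorm p q hm, mixedNorm_eq_mixedLNorm p q hm]
  refine mixedLNorm_congr_ae ?_
  filter_upwards [h] with z hz
  rw [hz]

/-- Boundedness of the twisted convolution on `L^{p,q}_m`, up to a scalar factor. -/
theorem mixedNorm_smul_stftConv_le (hv : IsSubmultWeight v)
    (hm : IsModerateWeight v m C) {p q : ℝ≥0∞} (hp : 1 ≤ p) (hq : 1 ≤ q) (R Q : HS (L2 d))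
    {Ψ : PhaseSpace d → HS (L2 d)} (hΨ : AEStronglyMeasurable Ψ volume) (c : ℂ) :
    mixedNorm p q m (fun z => c • stftConv R Q Ψ z) ≤
      ‖c‖ₑ * (ENNReal.ofReal C * mixedNorm 1 1 v (opSTFT R Q) * mixedNorm p q m Ψ) := by
  refine (mixedNorm_const_smul_le hm.pos p q c _).trans (mul_le_mul' le_rfl ?_)
  refine le_trans ?_ (mixedLNorm_weight_mul_stftConvBound_le hv hm hp hq R Q hΨ)
  rw [mixedNorm_eq_mixedLNorm p q hm.pos]
  exact mixedLNorm_mono fun z => mul_le_mul' le_rfl (enorm_stftConv_le R Q Ψ z)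

theorem memMixed_smul_stftConv (hv : IsSubmultWeight v)
    (hm : IsModerateWeight v m C) {p q : ℝ≥0∞} (hp : 1 ≤ p) (hq : 1 ≤ q) {R Q : HS (L2 d)}
    (hRQ : mixedNorm 1 1 v (opSTFT R Q) < ∞)
    {Ψ : PhaseSpace d → HS (L2 d)} (hΨ : MemMixed p q m Ψ) (c : ℂ) :
    MemMixed p q m (fun z => c • stftConv R Q Ψ z) :=
  ⟨(aestronglyMeasurable_stftConv R Q hΨ.1).const_smul (c : ℂ),
    (mixedNorm_smul_stftConv_le hv hm hp hq R Q hΨ.1 c).trans_lt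
      (ENNReal.mul_lt_top enorm_lt_top
        (ENNReal.mul_lt_top (ENNReal.mul_lt_top ENNReal.ofReal_lt_top hRQ) hΨ.2))⟩

theorem integrable_adjoint_tfShift_adjoint {R Q : HS (L2 d)} (hRQ : Integrable (opSTFT R Q))
    (w : PhaseSpace d) (b : L2 d) :
    Integrable fun z => R.op.adjoint ((tfShift z).adjoint (tfShift w (Q.op b))) := by
  simp_rw [← stftKernel_op_apply]
  refine ((hRQ.comp_sub_right w).norm.mul_const ‖b‖).mono' ?_
    (Filter.Eventually.of_forall fun z => ?_)
  · exact ((HS.evalL b).continuous.comp ((continuous_stftKernel R Q).comp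
      (continuous_id.prodMk continuous_const))).aestronglyMeasurable
  · rw [← norm_stftKernel]
    exact (stftKernel R Q z w).op.le_of_opNorm_le (HS.norm_op_le _) b

/-- Composition of the kernels: `∫ π(z') R R* π(z')* dz' = ‖R‖² I` removes the inner pair of
windows. -/
theorem integral_mulL_stftKernel_mulL_stftKernel (P : HS (L2 d)) {R Q : HS (L2 d)}
    (hRQ : Integrable (opSTFT R Q)) (z w : PhaseSpace d) (A : HS (L2 d))
    (h : Integrable fun z' => HS.mulL (stftKernel P R z z') (HS.mulL (stftKernel R Q z' w) A)) :
    ∫ z', HS.mulL (stftKernel P R z z') (HS.mulL (stftKernel R Q z' w) A) =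
      ((‖R‖ ^ 2 : ℝ) : ℂ) • HS.mulL (stftKernel P Q z w) A := by
  refine HS.ext_op fun x => ext_inner_left ℂ fun y => ?_
  rw [HS.inner_integral_op h]
  simp only [HS.mulL_op_apply, HS.smul_op, stftKernel_op_apply]
  rw [inner_smul_right, ContinuousLinearMap.adjoint_inner_right,
    ContinuousLinearMap.adjoint_inner_right,
    ← integral_inner_adjoint_tfShift_adjoint R _ _ (integrable_adjoint_tfShift_adjoint hRQ w _)]
  refine integral_congr_ae (Filter.Eventually.of_forall fun z' => ?_)
  simp only []
  rw [ContinuousLinearMap.adjoint_inner_right, ContinuousLinearMap.adjoint_inner_right,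
    ← ContinuousLinearMap.adjoint_inner_left, ← ContinuousLinearMap.adjoint_inner_left]

theorem integrable_mulL_stftKernel_mulL_stftKernel (P R Q : HS (L2 d))
    {Ψ : PhaseSpace d → HS (L2 d)} (hΨ : AEStronglyMeasurable Ψ volume) {z : PhaseSpace d}
    (hz : lconv (fun w => ‖opSTFT P R w‖ₑ) (stftConvBound R Q Ψ) z < ∞) :
    Integrable (fun y : PhaseSpace d × PhaseSpace d =>
      HS.mulL (stftKernel P R z y.1) (HS.mulL (stftKernel R Q y.1 y.2) (Ψ y.2)))
      (volume.prod volume) := by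
  have hm : AEStronglyMeasurable (fun y : PhaseSpace d × PhaseSpace d =>
      HS.mulL (stftKernel P R z y.1) (HS.mulL (stftKernel R Q y.1 y.2) (Ψ y.2)))
      (volume.prod volume) :=
    HS.mulL.aestronglyMeasurable_comp₂ ((continuous_stftKernel P R).comp
      (continuous_const.prodMk continuous_fst)).aestronglyMeasurable
      (aestronglyMeasurable_mulL_stftKernel_prod R Q hΨ)
  refine ⟨hm, ?_⟩
  rw [hasFiniteIntegral_iff_enorm, lintegral_prod _ hm.enorm]
  refine (lintegral_mono fun z' => ?_).trans_lt hz
  rw [stftConvBound, lconv, ← lintegral_const_mul' _ _ enorm_ne_top]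
  refine lintegral_mono fun w => (HS.enorm_mulL_le _ _).trans ?_
  rw [enorm_stftKernel]
  exact mul_le_mul' le_rfl (enorm_mulL_stftKernel_le R Q Ψ z' w)

/-- The reproducing formula: two successive changes of window, through the window `R`, are a
single one up to the factor `‖R‖²`. -/
theorem stftConv_stftConv (P : HS (L2 d)) {R Q : HS (L2 d)} (hRQ : Integrable (opSTFT R Q))
    {Ψ : PhaseSpace d → HS (L2 d)} (hΨ : AEStronglyMeasurable Ψ volume)
    (hb : ∀ᵐ z, stftConvBound R Q Ψ z < ∞) {z : PhaseSpace d}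
    (hz : lconv (fun w => ‖opSTFT P R w‖ₑ) (stftConvBound R Q Ψ) z < ∞) :
    stftConv P R (stftConv R Q Ψ) z = ((‖R‖ ^ 2 : ℝ) : ℂ) • stftConv P Q Ψ z := by
  have hint := integrable_mulL_stftKernel_mulL_stftKernel P R Q hΨ hz
  calc stftConv P R (stftConv R Q Ψ) z
      = ∫ z', ∫ w, HS.mulL (stftKernel P R z z') (HS.mulL (stftKernel R Q z' w) (Ψ w)) := by
        refine integral_congr_ae ?_
        filter_upwards [hb] with z' hz'
        exact ((HS.mulL (stftKernel P R z z')).integral_comp_comm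
          (integrable_mulL_stftKernel R Q hΨ hz')).symm
    _ = ∫ w, ∫ z', HS.mulL (stftKernel P R z z') (HS.mulL (stftKernel R Q z' w) (Ψ w)) :=
        integral_integral_swap hint
    _ = ∫ w, ((‖R‖ ^ 2 : ℝ) : ℂ) • HS.mulL (stftKernel P Q z w) (Ψ w) := by
        refine integral_congr_ae ?_
        filter_upwards [hint.prod_left_ae] with w hw
        exact integral_mulL_stftKernel_mulL_stftKernel P hRQ z w (Ψ w) hw
    _ = _ := integral_smul _ _

theorem ae_stftConv_stftConv (hv : IsSubmultWeight v) (hm : IsModerateWeight v m C)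
    {p q : ℝ≥0∞} (hp : 1 ≤ p) (hq : 1 ≤ q) {P R Q : HS (L2 d)}
    (hPR : mixedNorm 1 1 v (opSTFT P R) < ∞) (hRQ : mixedNorm 1 1 v (opSTFT R Q) < ∞)
    {Ψ : PhaseSpace d → HS (L2 d)} (hΨ : MemMixed p q m Ψ) :
    ∀ᵐ z, stftConv P R (stftConv R Q Ψ) z = ((‖R‖ ^ 2 : ℝ) : ℂ) • stftConv P Q Ψ z := by
  have hB := aemeasurable_stftConvBound R Q hΨ.1
  have hBt := temperedIntegrable_stftConvBound hv hm hp hq hRQ hΨ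
  have hL := (mixedLNorm_weight_mul_lconv_opSTFT_le hv hm hp hq P R hB).trans_lt
    (ENNReal.mul_lt_top (ENNReal.mul_lt_top ENNReal.ofReal_lt_top hPR)
      (mixedLNorm_weight_mul_stftConvBound_lt_top hv hm hp hq hRQ hΨ))
  have hLm : AEMeasurable (lconv (fun w => ‖opSTFT P R w‖ₑ) (stftConvBound R Q Ψ)) volume :=
    aemeasurable_lconv (continuous_opSTFT P R).enorm.measurable hB
  filter_upwards [(temperedIntegrable_of_mixedLNorm_weight_mul_lt_top hv hm hp hq hLm
    hL).ae_lt_top hLm] with z hz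
  exact stftConv_stftConv P (integrable_opSTFT hv hRQ) hΨ.1 (hBt.ae_lt_top hB) hz

end Reproducing

/-! ### Rank-one windows -/

section RankOne

variable {d : ℕ} {v m : PhaseSpace d → ℝ} {C : ℝ}

theorem HS.adjoint_tensor_op_apply {H : Type*} [NormedAddCommGroup H] [InnerProductSpace ℂ H]
    [CompleteSpace H] (x y h : H) : (HS.tensor x y).op.adjoint h = inner ℂ x h • y := by
  refine ext_inner_left ℂ fun u => ?_
  rw [ContinuousLinearMap.adjoint_inner_right, HS.tensor_op_apply, inner_smul_left,
    inner_smul_right, inner_conj_symm, mul_comm]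

theorem norm_opSTFT_tensor_right (R : HS (L2 d)) (x y : L2 d) (z : PhaseSpace d) :
    ‖opSTFT R (HS.tensor x y) z‖ = ‖R.op.adjoint ((tfShift z).adjoint x)‖ * ‖y‖ := by
  rw [← HS.norm_tensor]
  congr 1
  refine HS.ext_op fun h => ?_
  rw [opSTFT, HS.leftComp_op_apply, HS.tensor_op_apply, HS.tensor_op_apply, map_smul]
  rfl

theorem norm_opSTFT_tensor_left (R : HS (L2 d)) (x y : L2 d) (z : PhaseSpace d) :
    ‖opSTFT (HS.tensor x y) R z‖ = ‖R.op.adjoint (tfShift z x)‖ * ‖y‖ := by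
  rw [mul_comm, ← HS.norm_tensor]
  congr 1
  refine HS.ext_op fun h => ?_
  rw [opSTFT, HS.leftComp_op_apply, HS.tensor_op_apply, ContinuousLinearMap.comp_apply,
    HS.adjoint_tensor_op_apply, ContinuousLinearMap.adjoint_inner_right,
    ContinuousLinearMap.adjoint_inner_left]

theorem tfShift_zero (f : L2 d) : tfShift (0 : PhaseSpace d) f = f := by
  have h := congrArg (tfShift (0 : PhaseSpace d)).adjoint (tfShift_tfShift 0 0 f)
  simpa [tfShift_adjoint_tfShift, character] using h

theorem tfShift_eq_character_smul_adjoint (z : PhaseSpace d) (f : L2 d) :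
    tfShift z f = character z.2 z.1 • (tfShift (-z)).adjoint f := by
  have h := tfShift_adjoint_tfShift_eq 0 z f
  have h0 := tfShift_adjoint_tfShift (0 : PhaseSpace d) (tfShift z f)
  rw [tfShift_zero] at h0
  rw [h0] at h
  simpa using h

/-- The symmetry `‖V_R (x ⊗ y) (-z)‖ = ‖V_{x ⊗ y} R (z)‖`: up to a phase `π(-z)*` is `π(z)`. -/
theorem norm_opSTFT_tensor_neg (R : HS (L2 d)) (x y : L2 d) (z : PhaseSpace d) :
    ‖opSTFT R (HS.tensor x y) (-z)‖ = ‖opSTFT (HS.tensor x y) R z‖ := by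
  rw [norm_opSTFT_tensor_right, norm_opSTFT_tensor_left, tfShift_eq_character_smul_adjoint z x,
    map_smul, norm_smul, norm_character, one_mul]

theorem mixedNorm_opSTFT_tensor (hv : IsSubmultWeight v) (R : HS (L2 d)) (x y : L2 d) :
    mixedNorm 1 1 v (opSTFT R (HS.tensor x y)) = mixedNorm 1 1 v (opSTFT (HS.tensor x y) R) := by
  rw [mixedNorm_one_one_opSTFT hv, mixedNorm_one_one_opSTFT hv,
    ← (Measure.measurePreserving_neg (volume : Measure (PhaseSpace d))).lintegral_comp_emb
      (Homeomorph.neg (PhaseSpace d)).measurableEmbedding]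
  refine lintegral_congr fun z => ?_
  rw [hv.symm, ← ofReal_norm, norm_opSTFT_tensor_neg, ofReal_norm]

theorem IsSubmultWeight.temperedIntegrable (hv : IsSubmultWeight v) :
    TemperedIntegrable fun z => ENNReal.ofReal (v z) := by
  obtain ⟨A, N, hA⟩ := hv.growth
  have hA0 : 0 ≤ A := by simpa using (hv.pos 0).le.trans (hA 0)
  refine ⟨N + (Module.finrank ℝ (PhaseSpace d) + 1), ?_⟩
  have h1 : ∀ z : PhaseSpace d,
      ENNReal.ofReal (((1 + ‖z‖) ^ (N + (Module.finrank ℝ (PhaseSpace d) + 1)))⁻¹) *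
        ENNReal.ofReal (v z) ≤
      ENNReal.ofReal A *
        ENNReal.ofReal (((1 + ‖z‖) ^ (Module.finrank ℝ (PhaseSpace d) + 1))⁻¹) := fun z => by
    rw [← ENNReal.ofReal_mul (by positivity), ← ENNReal.ofReal_mul hA0]
    refine ENNReal.ofReal_le_ofReal ?_
    have h2 : 0 < 1 + ‖z‖ := by positivity
    refine (mul_le_mul_of_nonneg_left (hA z) (by positivity)).trans (le_of_eq ?_)
    rw [pow_add]
    field_simp
  refine (lintegral_mono h1).trans_lt ?_
  rw [lintegral_const_mul' _ _ ENNReal.ofReal_ne_top]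
  exact ENNReal.mul_lt_top ENNReal.ofReal_lt_top (lintegral_one_add_norm_pow_inv_lt_top _)

theorem enorm_opSTFT_gaussianWindow_tensor (e₀ g₀ : L2 d) (q : 𝓢(Euc d, ℂ)) (z : PhaseSpace d) :
    ‖opSTFT (gaussianWindow e₀) (HS.tensor (q.toLp 2) g₀) z‖ₑ =
      ‖stft (gaussianSchwartz d) q z‖ₑ * (‖e₀‖ₑ * ‖g₀‖ₑ) := by
  rw [stft_apply, toLp_gaussianSchwartz]
  generalize (q.toLp 2 : L2 d) = u
  rw [← ofReal_norm, norm_opSTFT_tensor_right, gaussianWindow, HS.adjoint_tensor_op_apply,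
    norm_smul, ContinuousLinearMap.adjoint_inner_right, mul_assoc,
    ENNReal.ofReal_mul (norm_nonneg _), ENNReal.ofReal_mul (norm_nonneg _), ofReal_norm,
    ofReal_norm, ofReal_norm]

theorem mixedNorm_opSTFT_gaussianWindow_tensor_lt_top (hv : IsSubmultWeight v) (e₀ g₀ : L2 d)
    (q : 𝓢(Euc d, ℂ)) :
    mixedNorm 1 1 v (opSTFT (gaussianWindow e₀) (HS.tensor (q.toLp 2) g₀)) < ∞ := by
  rw [mixedNorm_one_one_opSTFT hv]
  simp_rw [enorm_opSTFT_gaussianWindow_tensor, ← mul_assoc]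
  rw [lintegral_mul_const' _ _ enorm_ne_top, lintegral_mul_const' _ _ enorm_ne_top]
  refine ENNReal.mul_lt_top (ENNReal.mul_lt_top ?_ enorm_lt_top) enorm_lt_top
  simp_rw [mul_comm (ENNReal.ofReal _)]
  exact hv.temperedIntegrable.lintegral_schwartz_mul_lt_top _

theorem norm_gaussianWindow {e₀ : L2 d} (he₀ : ‖e₀‖ = 1) : ‖gaussianWindow e₀‖ = ‖gaussian d‖ := by
  rw [gaussianWindow, HS.norm_tensor, he₀, mul_one]

/-- The change of window from the Gaussian window `S₀` to `R`, by twisted convolution with `S₀`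
itself: it is the case `q = φ₀`, `g₀ = e₀`, in which the factor is `‖φ₀‖² = ‖S₀‖²`. -/
theorem IsOpSTFT.of_gaussianWindow {e₀ : L2 d} (he₀ : ‖e₀‖ = 1) (R : HS (L2 d))
    {T : TemperedOp d} {Ψ₀ : PhaseSpace d → HS (L2 d)} (hΨ : IsOpSTFT (gaussianWindow e₀) T Ψ₀)
    (hT : TemperedIntegrable (stftConvBound R (gaussianWindow e₀) Ψ₀)) :
    IsOpSTFT R T fun z => (((‖gaussianWindow e₀‖ ^ 2 : ℝ) : ℂ))⁻¹ •
      stftConv R (gaussianWindow e₀) Ψ₀ z := by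
  have hc : inner ℂ ((gaussianWindow e₀).op e₀) ((gaussianSchwartz d).toLp 2 : L2 d) =
      ((‖gaussianWindow e₀‖ ^ 2 : ℝ) : ℂ) := by
    rw [toLp_gaussianSchwartz, norm_gaussianWindow he₀, gaussianWindow, HS.tensor_op_apply,
      inner_self_eq_norm_sq_to_K, he₀, inner_smul_left, inner_self_eq_norm_sq_to_K]
    simp
  have h0 : ((‖gaussianWindow e₀‖ ^ 2 : ℝ) : ℂ) ≠ 0 := by
    rw [norm_gaussianWindow he₀]
    simpa using gaussian_ne_zero d
  have h := hΨ.changeWindow (R := R) (gaussianSchwartz d) e₀ (by rwa [hc])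
  rw [hc, toLp_gaussianSchwartz] at h
  exact h hT

theorem exists_schwartz_inner_ne_zero {R : HS (L2 d)} (hR : R ≠ 0) :
    ∃ (q : 𝓢(Euc d, ℂ)) (g₀ : L2 d), inner ℂ (R.op g₀) (q.toLp 2 : L2 d) ≠ 0 := by
  by_contra! hcon
  refine hR (HS.ext_op fun g => ?_)
  refine (denseRange_toLp_two (d := d)).eq_of_inner_left ℂ fun q => ?_
  rw [hcon q g]
  exact (inner_zero_left _).symm

end RankOne

/-! ### Independence of the window -/

section Main

variable {d : ℕ} {v m : PhaseSpace d → ℝ} {C : ℝ} {p q : ℝ≥0∞}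

theorem IsOpSTFT.memMixed_of_memMixed (hm : ∀ z, 0 < m z) {S : HS (L2 d)} {T : TemperedOp d}
    {Ψ Ψ' : PhaseSpace d → HS (L2 d)} (hΨ : IsOpSTFT S T Ψ) (hΨ' : IsOpSTFT S T Ψ')
    (h : MemMixed p q m Ψ') : MemMixed p q m Ψ :=
  ⟨hΨ.1, by rw [mixedNorm_congr_ae hm p q (hΨ.ae_eq hΨ')]; exact h.2⟩

/-- The transform for the Gaussian window is recovered from the one for the window `R` by a
twisted convolution with `R`. The window `R` is not of the form `q ⊗ g₀` with `q` a Schwartz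
function, so `IsOpSTFT.changeWindow` does not apply; the reproducing formula does, because the
transform for `R` is itself a twisted convolution of `Ψ₀`. -/
theorem ae_eq_smul_stftConv_gaussianWindow (hv : IsSubmultWeight v) (hm : IsModerateWeight v m C)
    (hp : 1 ≤ p) (hq : 1 ≤ q) {e₀ : L2 d} (he₀ : ‖e₀‖ = 1) {R : HS (L2 d)} (hR0 : R ≠ 0)
    (hSR : mixedNorm 1 1 v (opSTFT (gaussianWindow e₀) R) < ∞)
    (hRS : mixedNorm 1 1 v (opSTFT R (gaussianWindow e₀)) < ∞)
    {T : TemperedOp d} {Ψ₀ Ψ : PhaseSpace d → HS (L2 d)}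
    (hΨ₀ : IsOpSTFT (gaussianWindow e₀) T Ψ₀) (hΨ : IsOpSTFT R T Ψ) (hmem : MemMixed p q m Ψ₀) :
    Ψ₀ =ᵐ[volume] fun z => (((‖R‖ ^ 2 : ℝ) : ℂ))⁻¹ • stftConv (gaussianWindow e₀) R Ψ z := by
  have hSS : mixedNorm 1 1 v (opSTFT (gaussianWindow e₀) (gaussianWindow e₀)) < ∞ := by
    have h := mixedNorm_opSTFT_gaussianWindow_tensor_lt_top hv e₀ e₀ (gaussianSchwartz d)
    rwa [toLp_gaussianSchwartz] at h
  have h1 := hΨ.ae_eq (hΨ₀.of_gaussianWindow he₀ R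
    (temperedIntegrable_stftConvBound hv hm hp hq hRS hmem))
  have h2 := hΨ₀.ae_eq (hΨ₀.of_gaussianWindow he₀ (gaussianWindow e₀)
    (temperedIntegrable_stftConvBound hv hm hp hq hSS hmem))
  rw [stftConv_congr_ae _ _ h1]
  filter_upwards [h2, ae_stftConv_stftConv hv hm hp hq hSR hRS hmem] with z hz hz'
  have hR2 : ((‖R‖ ^ 2 : ℝ) : ℂ) ≠ 0 := by simpa using hR0
  rw [stftConv_const_smul, hz', hz, smul_comm _ ((‖R‖ ^ 2 : ℝ) : ℂ), inv_smul_smul₀ hR2]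

theorem opCoorbitWith_eq_opCoorbit (hv : IsSubmultWeight v) (hm : IsModerateWeight v m C)
    (hp : 1 ≤ p) (hq : 1 ≤ q) {e₀ : L2 d} (he₀ : ‖e₀‖ = 1) {R : HS (L2 d)} (hR0 : R ≠ 0)
    (hRS : mixedNorm 1 1 v (opSTFT R (gaussianWindow e₀)) < ∞) :
    opCoorbitWith R p q m = opCoorbit e₀ p q m := by
  refine Set.Subset.antisymm ?_ ?_
  · rintro T ⟨Ψ, hΨ, hmem⟩
    obtain ⟨k, g₀, hc⟩ := exists_schwartz_inner_ne_zero hR0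
    have hSQ := mixedNorm_opSTFT_gaussianWindow_tensor_lt_top hv e₀ g₀ k
    exact ⟨_, hΨ.changeWindow k g₀ hc (temperedIntegrable_stftConvBound hv hm hp hq hSQ hmem),
      memMixed_smul_stftConv hv hm hp hq hSQ hmem _⟩
  · rintro T ⟨Ψ₀, hΨ₀, hmem⟩
    exact ⟨_, hΨ₀.of_gaussianWindow he₀ R
      (temperedIntegrable_stftConvBound hv hm hp hq hRS hmem),
      memMixed_smul_stftConv hv hm hp hq hRS hmem _⟩

theorem enorm_inv_ofReal_sq {x : ℝ} (hx : x ≠ 0) :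
    ‖(((x ^ 2 : ℝ) : ℂ))⁻¹‖ₑ = (ENNReal.ofReal (x ^ 2))⁻¹ := by
  have : 0 < x ^ 2 := by positivity
  rw [← ofReal_norm, norm_inv, Complex.norm_real, Real.norm_of_nonneg this.le,
    ENNReal.ofReal_inv_of_pos this]

end Main

theorem mainTheorem4 {d : ℕ} (v m : PhaseSpace d → ℝ) (C : ℝ)
    (hv : IsSubmultWeight v) (hm : IsModerateWeight v m C)
    (p q : ℝ≥0∞) (hp : 1 ≤ p) (hq : 1 ≤ q)
    (e₀ : L2 d) (he₀ : ‖e₀‖ = 1)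
    (R : HS (L2 d)) (hR : R ∈ opM1 e₀ v) (hR0 : R ≠ 0) :
    MemMixed 1 1 v (opSTFT R (gaussianWindow e₀)) ∧
    opCoorbitWith R p q m = opCoorbit e₀ p q m ∧
    ∀ (T : TemperedOp d) (Ψ₀ Ψ : PhaseSpace d → HS (L2 d)), T ∈ opCoorbit e₀ p q m →
      IsOpSTFT (gaussianWindow e₀) T Ψ₀ → IsOpSTFT R T Ψ →
      ENNReal.ofReal (‖R‖ ^ 2) /
            (ENNReal.ofReal C * mixedNorm 1 1 v (opSTFT (gaussianWindow e₀) R)) *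
          mixedNorm p q m Ψ₀ ≤ mixedNorm p q m Ψ ∧
      mixedNorm p q m Ψ ≤
        ENNReal.ofReal C * mixedNorm 1 1 v (opSTFT R (gaussianWindow e₀)) /
            ENNReal.ofReal (‖gaussianWindow e₀‖ ^ 2) *
          mixedNorm p q m Ψ₀ := by
  have hSR : mixedNorm 1 1 v (opSTFT (gaussianWindow e₀) R) < ∞ := hR.2
  have hRS : mixedNorm 1 1 v (opSTFT R (gaussianWindow e₀)) < ∞ := by
    rwa [gaussianWindow, mixedNorm_opSTFT_tensor hv]
  refine ⟨⟨(continuous_opSTFT R _).aestronglyMeasurable, hRS⟩,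
    opCoorbitWith_eq_opCoorbit hv hm hp hq he₀ hR0 hRS, ?_⟩
  rintro T Ψ₀ Ψ ⟨Ψ₁, hΨ₁, hmem₁⟩ hΨ₀ hΨ
  -- Membership of `T` provides some transform in `L^{p,q}_m`; by uniqueness it is `Ψ₀`.
  have hmem := hΨ₀.memMixed_of_memMixed hm.pos hΨ₁ hmem₁
  constructor
  · have h := mixedNorm_smul_stftConv_le hv hm hp hq (gaussianWindow e₀) R hΨ.1
      (((‖R‖ ^ 2 : ℝ) : ℂ))⁻¹
    rw [← mixedNorm_congr_ae hm.pos p q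
      (ae_eq_smul_stftConv_gaussianWindow hv hm hp hq he₀ hR0 hSR hRS hΨ₀ hΨ hmem),
      enorm_inv_ofReal_sq (norm_ne_zero_iff.2 hR0)] at h
    refine (mul_le_mul' le_rfl h).trans ?_
    generalize ENNReal.ofReal C * mixedNorm 1 1 v (opSTFT (gaussianWindow e₀) R) = b
    generalize ENNReal.ofReal (‖R‖ ^ 2) = a
    calc a / b * (a⁻¹ * (b * mixedNorm p q m Ψ))
        = (a * a⁻¹) * (b⁻¹ * b) * mixedNorm p q m Ψ := by rw [div_eq_mul_inv]; ring
      _ ≤ 1 * 1 * mixedNorm p q m Ψ := by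
          gcongr
          · exact ENNReal.mul_inv_le_one a
          · exact ENNReal.inv_mul_le_one b
      _ = mixedNorm p q m Ψ := by rw [one_mul, one_mul]
  · have hne : ‖gaussianWindow e₀‖ ≠ 0 := by
      rw [norm_gaussianWindow he₀]
      exact norm_ne_zero_iff.2 (gaussian_ne_zero d)
    rw [mixedNorm_congr_ae hm.pos p q (hΨ.ae_eq (hΨ₀.of_gaussianWindow he₀ R
      (temperedIntegrable_stftConvBound hv hm hp hq hRS hmem)))]
    refine (mixedNorm_smul_stftConv_le hv hm hp hq R _ hΨ₀.1 _).trans (le_of_eq ?_)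
    rw [enorm_inv_ofReal_sq hne, div_eq_mul_inv]
    ring

end
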